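/- Let $\hbar,M,L>0$, $\nu,\beta\ge 0$, $\varepsilon_0=\hbar^2\pi^2/(2ML^2)$. On $L^2(0,L)$ consider the Pöschl–Teller Hamiltonian $$H=-\frac{\hbar^2}{2M}\frac{d^2}{dx^2}+\varepsilon_0\Big(\frac{\nu(\nu+1)}{\sin^2(\pi x/L)}-2\beta\cot\frac{\pi x}{L}\Big)$$ with Dirichlet boundary conditions. For $n\in\mathbb N=\{0,1,2,\dots\}$ put $E_n=\varepsilon_0\big((n+\nu+1)^2-\frac{\beta^2}{(n+\nu+1)^2}\big)$, $a_n=-(n+\nu+1)+\frac{i\beta}{n+\nu+1}$, and $$\phi_n(x)=K_n\sin^{\nu+n+1}\Big(\frac{\pi x}{L}\Big)\exp\Big(-\frac{\beta\pi x}{L(\nu+n+1)}\Big)P_n^{(a_n,\bar a_n)}\Big(i\cot\frac{\pi x}{L}\Big),$$ $$K_n=2^{n+\nu+1}L^{-1/2}\,\mathcal T(n)\,\mathcal O(n)^{-1/2}\exp\Big(\frac{\beta\pi}{2(n+\nu+1)}\Big),\qquad \mathcal T(n)=n!\,\Big|\Big(-n-\nu+\frac{i\beta}{n+\nu+1}\Big)_n\Big|^{-1},$$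 $$\mathcal O(n)=\sum_{k=0}^n\frac{(-n)_k(-2\nu-n-1)_k}{(-\nu-n-\frac{i\beta}{\nu+n+1})_k\,k!\,\Gamma(n+\nu+2-k+\frac{i\beta}{\nu+n+1})}\sum_{s=0}^n\frac{(-n)_s(-2\nu-n-1)_s\,\Gamma(2n+2\nu-s-k+3)}{(-\nu-n+\frac{i\beta}{\nu+n+1})_s\,s!\,\Gamma(n+\nu+2-s-\frac{i\beta}{\nu+n+1})},$$ where $P_n^{(a,b)}$ are the Jacobi polynomials and $(z)_k=z(z+1)\cdots(z+k-1)$. Define recursively, for $k=0,1,2,\dots$, $$\phi_n^{(k)}=\frac{A_{k-1}\cdots A_1A_0\,\phi_{n+k}}{\sqrt{(2M)^k\prod_{j=0}^{k-1}(E_{n+k}-E_j)}},\quad W_k=-\hbar\frac{(\phi_0^{(k)})'}{\phi_0^{(k)}},\quad A_k=\hbar\frac{d}{dx}+W_k,\quad A_k^\dagger=-\hbar\frac{d}{dx}+W_k,$$ with $A_k$ taken on its maximal domain in $L^2(0,L)$ and $A_k^\dagger$ its adjoint, and put $E_n^{(k)}=E_{n+k}$, $H^{(m+1)}=\frac1{2M}A_mA_m^\dagger+E_0^{(m)}$,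 $B_m=A_m\cdots A_1A_0$, $B_m^\dagger=A_0^\dagger A_1^\dagger\cdots A_m^\dagger$. Then for all $n,m\in\mathbb N$ the $\phi_j^{(k)}$ ($k\le m+1$, $j\in\mathbb N$) are well-defined smooth functions on $(0,L)$, the ground states $\phi_0^{(k)}$ ($k\le m$) having no zeros there; $\phi_n$ and $\phi_n^{(m+1)}$ are normalized eigenfunctions of $H$ and $H^{(m+1)}$ for the eigenvalues $E_n$ and $E_n^{(m+1)}$; the function $\phi_n^{(m+1)}$ lies in the domain of $B_m^\dagger$ and $\phi_{n+m+1}$ in the domain of $B_m$; and for all $x\in(0,L)$ $$\begin{aligned}B_m^\dagger\phi_n^{(m+1)}(x)={}&2^{n+m+\nu+2}\Big(\frac{\hbar\pi}{L}\Big)^{m+1}\mathcal T(n+m+1)\,\big[L\,\mathcal O(n+m+1)\big]^{-1/2}\exp\Big[\frac{\beta\pi}{n+m+\nu+2}\Big(\frac12-\frac xL\Big)\Big]\\&\times\mathcal M(n,m)\,\sin^{n+m+\nu+2}\Big(\frac{\pi x}{L}\Big)\,P_{n+m+1}^{(a_{n+m+1},\bar a_{n+m+1})}\Big(i\cot\frac{\pi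 x}{L}\Big),\end{aligned}$$ $$B_m\phi_{n+m+1}(x)=\Big(\frac{\pi\hbar}{L}\Big)^{m+1}\mathcal M(n,m)\,\phi_n^{(m+1)}(x),$$ where $\mathcal M(n,m)>0$ is given by $$\mathcal M^2(n,m)=\prod_{k=0}^m(n+m-k+1)(n+m+2\nu+k+3)\Big(1+\frac{\beta^2}{[(k+\nu+1)(n+m+\nu+2)]^2}\Big).$$ -/

import Mathlib

open MeasureTheory Set Filter Topology
open scoped ContDiff

noncomputable section

/-- The Jacobi polynomial `P_n^{(a,b)}(z)`, for arbitrary complex parameters: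
`∑_{k ≤ n} (n+a+b+1)_k (a+k+1)_{n-k} / (k! (n-k)!) ((z-1)/2)^k`. -/
def jacobiP (n : ℕ) (a b z : ℂ) : ℂ :=
  ∑ k ∈ Finset.range (n + 1),
    (ascPochhammer ℂ k).eval (n + a + b + 1) * (ascPochhammer ℂ (n - k)).eval (a + k + 1)
      / ((k.factorial : ℂ) * ((n - k).factorial : ℂ)) * ((z - 1) / 2) ^ k

/-- The parameters of the model: Planck's constant `ħ`, the mass `M`, the width `L` of the interval
`[0, L]`, and the dimensionless parameters `ν`, `β`. -/
structure PoschlTeller where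
  ħ : ℝ
  M : ℝ
  L : ℝ
  ν : ℝ
  β : ℝ

namespace PoschlTeller

variable (p : PoschlTeller)

/-! ### The Hamiltonian, its eigenvalues and its eigenfunctions -/

/-- The energy scale `ε₀ = ħ² π² / (2 M L²)`. -/
def eps0 : ℝ := p.ħ ^ 2 * Real.pi ^ 2 / (2 * p.M * p.L ^ 2)

/-- The potential `V(x) = ε₀ (ν(ν+1) / sin²(πx/L) - 2β cot(πx/L))`. -/
def potential (x : ℝ) : ℝ :=
  p.eps0 * (p.ν * (p.ν + 1) / Real.sin (Real.pi * x / p.L) ^ 2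
    - 2 * p.β * Real.cot (Real.pi * x / p.L))

/-- The eigenvalue `E_n = ε₀ ((n+ν+1)² - β² / (n+ν+1)²)`. -/
def energy (n : ℕ) : ℝ :=
  p.eps0 * ((n + p.ν + 1) ^ 2 - p.β ^ 2 / (n + p.ν + 1) ^ 2)

/-- `a_n = -(n+ν+1) + i β / (n+ν+1)`. -/
def aParam (n : ℕ) : ℂ :=
  -((n : ℂ) + p.ν + 1) + Complex.I * p.β / ((n : ℂ) + p.ν + 1)

/-- `T(n) = n! / |(-n-ν + iβ/(n+ν+1))_n|`. -/
def calT (n : ℕ) : ℝ :=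
  (n.factorial : ℝ) *
    ‖(ascPochhammer ℂ n).eval (-(n : ℂ) - p.ν + Complex.I * p.β / ((n : ℂ) + p.ν + 1))‖⁻¹

/-- The double sum `O(n)`, written as the complex expression it is (its value is real). -/
def calO (n : ℕ) : ℂ :=
  ∑ k ∈ Finset.range (n + 1),
    (ascPochhammer ℂ k).eval (-(n : ℂ)) * (ascPochhammer ℂ k).eval (-2 * (p.ν : ℂ) - n - 1)
      / ((ascPochhammer ℂ k).eval (-(p.ν : ℂ) - n - Complex.I * p.β / ((n : ℂ) + p.ν + 1))
          * (k.factorial : ℂ)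
          * Complex.Gamma (n + p.ν + 2 - k + Complex.I * p.β / ((n : ℂ) + p.ν + 1)))
      * ∑ s ∈ Finset.range (n + 1),
          (ascPochhammer ℂ s).eval (-(n : ℂ)) * (ascPochhammer ℂ s).eval (-2 * (p.ν : ℂ) - n - 1)
            * Complex.Gamma (2 * n + 2 * p.ν - s - k + 3)
            / ((ascPochhammer ℂ s).eval (-(p.ν : ℂ) - n + Complex.I * p.β / ((n : ℂ) + p.ν + 1))
                * (s.factorial : ℂ)
                * Complex.Gamma (n + p.ν + 2 - s - Complex.I * p.β / ((n : ℂ) + p.ν + 1)))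

/-- The normalization constant `K_n = 2^{n+ν+1} L^{-1/2} T(n) O(n)^{-1/2} exp(βπ/(2(n+ν+1)))`. -/
def normK (n : ℕ) : ℂ :=
  ((2 : ℝ) ^ ((n : ℝ) + p.ν + 1) : ℝ) * ((p.L ^ (-(1 / 2) : ℝ) : ℝ) : ℂ) * p.calT n
    * p.calO n ^ (-(1 / 2) : ℂ) * (Real.exp (p.β * Real.pi / (2 * (n + p.ν + 1))) : ℝ)

/-- The eigenfunction
`φ_n(x) = K_n sin^{ν+n+1}(πx/L) exp(-βπx/(L(ν+n+1))) P_n^{(a_n, conj a_n)}(i cot(πx/L))`. -/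
def phi (n : ℕ) (x : ℝ) : ℂ :=
  p.normK n * ((Real.sin (Real.pi * x / p.L) ^ (p.ν + n + 1) : ℝ) : ℂ)
    * (Real.exp (-(p.β * Real.pi * x / (p.L * (p.ν + n + 1)))) : ℝ)
    * jacobiP n (p.aParam n) (starRingEnd ℂ (p.aParam n))
        (Complex.I * (Real.cot (Real.pi * x / p.L) : ℝ))

/-! ### The hierarchy

All differential expressions act on functions `ℝ → ℂ`, of which only the restriction to the open
interval `(0, L)` matters. -/

/-- The superpotential `-ħ g' / g` attached to a ground state `g`. -/
def superpotOf (g : ℝ → ℂ) (x : ℝ) : ℂ := -(p.ħ : ℂ) * deriv g x / g x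

/-- `√((2M)^k ∏_{j<k} (E_{n+k} - E_j))`. -/
def normHier (k n : ℕ) : ℝ :=
  Real.sqrt ((2 * p.M) ^ k * ∏ j ∈ Finset.range k, (p.energy (n + k) - p.energy j))

/-- The product `A_{k-1} ⋯ A_1 A_0` (the identity for `k = 0`). The next factor is
`A_k = ħ d/dx + W_k`, with `W_k` the superpotential of the ground state of level `k`, which is
itself obtained from `φ_k` by the product of the first `k` factors; see `ladder_succ`. -/
def ladder : ℕ → (ℝ → ℂ) → ℝ → ℂ
  | 0, f => f
  | k + 1, f => fun x =>
      (p.ħ : ℂ) * deriv (ladder k f) x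
        + p.superpotOf (fun y => ladder k (p.phi (0 + k)) y / (p.normHier k 0 : ℂ)) x
          * ladder k f x

/-- The eigenfunction of level `k`,
`φ_n^{(k)} = A_{k-1} ⋯ A_0 φ_{n+k} / √((2M)^k ∏_{j<k} (E_{n+k} - E_j))`. -/
def phiHier (k n : ℕ) (x : ℝ) : ℂ := p.ladder k (p.phi (n + k)) x / (p.normHier k n : ℂ)

/-- The superpotential of level `k`, `W_k = -ħ (φ_0^{(k)})' / φ_0^{(k)}`. -/
def superpot (k : ℕ) : ℝ → ℂ := p.superpotOf (p.phiHier k 0)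

/-- `A_k = ħ d/dx + W_k`. -/
def opA (k : ℕ) (f : ℝ → ℂ) (x : ℝ) : ℂ := (p.ħ : ℂ) * deriv f x + p.superpot k x * f x

/-- `A_k† = -ħ d/dx + W_k`. -/
def opAdag (k : ℕ) (f : ℝ → ℂ) (x : ℝ) : ℂ := -(p.ħ : ℂ) * deriv f x + p.superpot k x * f x

theorem ladder_succ (k : ℕ) (f : ℝ → ℂ) : p.ladder (k + 1) f = p.opA k (p.ladder k f) := rfl

/-- The product `A_0† A_1† ⋯ A_{k-1}†` (the identity for `k = 0`). -/
def ladderDag : ℕ → (ℝ → ℂ) → ℝ → ℂ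
  | 0, f => f
  | k + 1, f => ladderDag k (p.opAdag k f)

/-- `B_m = A_m ⋯ A_1 A_0`. -/
def opB (m : ℕ) (f : ℝ → ℂ) : ℝ → ℂ := p.ladder (m + 1) f

/-- `B_m† = A_0† A_1† ⋯ A_m†`. -/
def opBdag (m : ℕ) (f : ℝ → ℂ) : ℝ → ℂ := p.ladderDag (m + 1) f

/-- The eigenvalues of the hierarchy: `E_n^{(0)} = E_n`, `E_n^{(m+1)} = E_{n+1}^{(m)}`. -/
def energyHier : ℕ → ℕ → ℝ
  | 0, n => p.energy n
  | m + 1, n => energyHier m (n + 1)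

/-- The Hamiltonian `H f = -(ħ²/2M) f'' + V f`. -/
def hamiltonian (f : ℝ → ℂ) (x : ℝ) : ℂ :=
  -((p.ħ ^ 2 / (2 * p.M) : ℝ) : ℂ) * deriv (deriv f) x + (p.potential x : ℂ) * f x

/-- The superpartner Hamiltonian `H^{(m+1)} f = (1/2M) A_m A_m† f + E_0^{(m)} f`. -/
def hamiltonianHier (m : ℕ) (f : ℝ → ℂ) (x : ℝ) : ℂ :=
  ((1 / (2 * p.M) : ℝ) : ℂ) * p.opA m (p.opAdag m f) x + (p.energyHier m 0 : ℂ) * f x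

/-! ### Domains in `L²(0, L)` -/

/-- `f` (restricted to `(0, L)`) belongs to `L²(0, L)`. -/
def MemL2 (f : ℝ → ℂ) : Prop := MemLp f 2 (volume.restrict (Ioo 0 p.L))

/-- The inner product of `L²(0, L)`, conjugate-linear in the first variable. -/
def innerL2 (u v : ℝ → ℂ) : ℂ := ∫ x in Ioo 0 p.L, starRingEnd ℂ (u x) * v x

/-- `f` is absolutely continuous on every compact subinterval of `(0, L)`. -/
def LocAC (f : ℝ → ℂ) : Prop :=
  ∀ a b : ℝ, 0 < a → a < b → b < p.L → AbsolutelyContinuousOnInterval f a b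

/-- The domain of `A_k` in `L²(0, L)`. -/
def MemDomA (k : ℕ) (f : ℝ → ℂ) : Prop :=
  p.MemL2 f ∧ p.LocAC f ∧ p.MemL2 (p.opA k f)

/-- The domain of `A_k†`, the adjoint of `A_k` in `L²(0, L)`: for all `ψ` in the domain of `A_k`
the boundary terms `ħ conj(ψ) f` at `0` and at `L` cancel and `⟨A_k ψ, f⟩ = ⟨ψ, A_k† f⟩`. -/
def MemDomAdag (k : ℕ) (f : ℝ → ℂ) : Prop :=
  p.MemL2 f ∧ p.LocAC f ∧ p.MemL2 (p.opAdag k f) ∧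
    ∀ ψ : ℝ → ℂ, p.MemDomA k ψ →
      (∃ c : ℂ,
        Tendsto (fun x => (p.ħ : ℂ) * starRingEnd ℂ (ψ x) * f x) (𝓝[>] 0) (𝓝 c) ∧
        Tendsto (fun x => (p.ħ : ℂ) * starRingEnd ℂ (ψ x) * f x) (𝓝[<] p.L) (𝓝 c)) ∧
      p.innerL2 (p.opA k ψ) f = p.innerL2 ψ (p.opAdag k f)

/-- The domain of the product `A_{k-1} ⋯ A_0` of unbounded operators. -/
def MemDomLadder : ℕ → (ℝ → ℂ) → Prop
  | 0, f => p.MemL2 f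
  | k + 1, f => MemDomLadder k f ∧ p.MemDomA k (p.ladder k f)

/-- The domain of the product `A_0† ⋯ A_{k-1}†` of unbounded operators. -/
def MemDomLadderDag : ℕ → (ℝ → ℂ) → Prop
  | 0, f => p.MemL2 f
  | k + 1, f => p.MemDomAdag k f ∧ MemDomLadderDag k (p.opAdag k f)

/-- The domain of `B_m`. -/
def MemDomB (m : ℕ) (f : ℝ → ℂ) : Prop := p.MemDomLadder (m + 1) f

/-- The domain of `B_m†`. -/
def MemDomBdag (m : ℕ) (f : ℝ → ℂ) : Prop := p.MemDomLadderDag (m + 1) f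

/-- The domain of `H`: functions in `L²` which are locally absolutely continuous together with
their derivative, satisfy Dirichlet boundary conditions, and are mapped to `L²` by `H`. -/
def MemDomH (f : ℝ → ℂ) : Prop :=
  p.MemL2 f ∧ p.LocAC f ∧ p.LocAC (deriv f) ∧
    Tendsto f (𝓝[>] 0) (𝓝 0) ∧ Tendsto f (𝓝[<] p.L) (𝓝 0) ∧ p.MemL2 (p.hamiltonian f)

/-- The domain of `H^{(m+1)} = (1/2M) A_m A_m† + E_0^{(m)}`. -/
def MemDomHHier (m : ℕ) (f : ℝ → ℂ) : Prop :=
  p.MemDomAdag m f ∧ p.MemDomA m (p.opAdag m f)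

/-- `f` is a unit vector of `L²(0, L)`. -/
def IsUnitVector (f : ℝ → ℂ) : Prop := p.MemL2 f ∧ p.innerL2 f f = 1

/-- `f` is a normalized eigenfunction of `H` with eigenvalue `E`. -/
def IsNormalizedEigenfunction (E : ℝ) (f : ℝ → ℂ) : Prop :=
  p.MemDomH f ∧ p.IsUnitVector f ∧ ∀ x ∈ Ioo 0 p.L, p.hamiltonian f x = (E : ℂ) * f x

/-- `f` is a normalized eigenfunction of `H^{(m+1)}` with eigenvalue `E`. -/
def IsNormalizedEigenfunctionHier (m : ℕ) (E : ℝ) (f : ℝ → ℂ) : Prop :=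
  p.MemDomHHier m f ∧ p.IsUnitVector f ∧ ∀ x ∈ Ioo 0 p.L, p.hamiltonianHier m f x = (E : ℂ) * f x

/-- The positive square root `M(n,m)` of
`∏_{k=0}^m (n+m-k+1)(n+m+2ν+k+3)(1 + β²/[(k+ν+1)(n+m+ν+2)]²)`. -/
def calM (n m : ℕ) : ℝ :=
  Real.sqrt (∏ k ∈ Finset.range (m + 1),
    ((n : ℝ) + m - k + 1) * ((n : ℝ) + m + 2 * p.ν + k + 3)
      * (1 + p.β ^ 2 / (((k : ℝ) + p.ν + 1) * ((n : ℝ) + m + p.ν + 2)) ^ 2))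

end PoschlTeller

end

/-! In the angle θ = πx/L every function of the hierarchy is a constant times a wave sin^{n+ν+1}θ ·
exp(-βθ/(n+ν+1)) · R(cot θ) with a polynomial R. The prefactor of index k has logarithmic derivative
`groundPoly k`, evaluated at cot θ, so d/dθ acts on R by `derivPoly`. As soon as W_k is known to be
-(ħπ/L) times `groundPoly k`, the operators A_k and A_k† act on R, up to the factor ħπ/L, by
`raisePoly` and `lowerPoly`.

Algebra: A_k A_k† and A_{k+1}† A_{k+1} differ by a constant, the energy gap (shape invariance,
`raisePoly_lowerPoly`), and Jacobi's equation diagonalizes A_0† A_0 on φ_n. Induction on k then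
gives that A_k† undoes A_k on the descendants of φ_n up to the gap E_n - E_k
(`lowerPoly_hierPoly_succ`). The same relation controls degrees: after k ≤ n steps the degree is at
most n - k, and after n steps a nonzero constant is left. So the ground state of level k is the bare
prefactor; it has no zeros, and W_k has the expected form (`hasExplicitSuperpot`, a strong
induction, since level k is built from the earlier W_j). The constant M(n,m)² is the product of the
gaps in units of ε₀.

Domains: degree at most n leaves a spare factor sin θ. Against it, a nonzero boundary value of
conj(ψ) f would force a singularity like 1/x in an integrable function, so boundary terms vanish for
every ψ in the maximal domain of A_k (`memDomAdag_of_vanishesAtEnds`).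

Norms: |φ_n|² expands into a double sum of Cauchy integrals ∫ sin^s θ e^{iy(θ-π/2)} dθ, whose
Gamma-function values assemble into O(n). This normalizes φ_n and shows O(n) > 0. The norms at
higher levels follow from adjointness, each step contributing one gap. -/

noncomputable section

/-! ### Cauchy's integral via a recurrence in s and its large-s asymptotics -/

/-- The integral `∫_0^π sin^s θ exp(i y (θ - π/2)) dθ`. -/
def sinExpIntegral (s : ℝ) (y : ℂ) : ℂ :=
  ∫ θ in (0 : ℝ)..Real.pi,
    ((Real.sin θ ^ s : ℝ) : ℂ) * Complex.exp (Complex.I * y * ((θ : ℂ) - Real.pi / 2))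

theorem continuous_sin_rpow {s : ℝ} (hs : 0 ≤ s) : Continuous fun θ : ℝ => Real.sin θ ^ s :=
  Real.continuous_sin.rpow_const fun _ => Or.inr hs

theorem continuous_sinExp {s : ℝ} (hs : 0 ≤ s) (y : ℂ) :
    Continuous fun θ : ℝ =>
      ((Real.sin θ ^ s : ℝ) : ℂ) * Complex.exp (Complex.I * y * ((θ : ℂ) - Real.pi / 2)) := by
  have := continuous_sin_rpow hs
  fun_prop

theorem sinExpIntegral_add_two {s : ℝ} (hs : 1 ≤ s) (y : ℂ) :
    (((s : ℂ) + 2) ^ 2 - y ^ 2) * sinExpIntegral (s + 2) y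
      = (s + 1) * (s + 2) * sinExpIntegral s y := by
  have key : ∫ θ in (0 : ℝ)..Real.pi,
      ((((s : ℂ) + 2) ^ 2 - y ^ 2) * (((Real.sin θ ^ (s + 2) : ℝ) : ℂ) *
          Complex.exp (Complex.I * y * ((θ : ℂ) - Real.pi / 2)))
        - (s + 1) * (s + 2) * (((Real.sin θ ^ s : ℝ) : ℂ) *
          Complex.exp (Complex.I * y * ((θ : ℂ) - Real.pi / 2)))) = 0 := by
    -- This explicit antiderivative packages two integrations by parts; it vanishes at 0 and π
    -- because both of its terms carry positive powers of sin.
    have hderiv : ∀ θ ∈ uIcc 0 Real.pi, HasDerivAt (fun θ : ℝ =>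
        (Complex.I * y * ((Real.sin θ ^ (s + 2) : ℝ) : ℂ)
          - (s + 2) * (((Real.sin θ ^ (s + 1) : ℝ) : ℂ) * (Real.cos θ : ℂ))) *
          Complex.exp (Complex.I * y * ((θ : ℂ) - Real.pi / 2)))
        ((((s : ℂ) + 2) ^ 2 - y ^ 2) * (((Real.sin θ ^ (s + 2) : ℝ) : ℂ) *
          Complex.exp (Complex.I * y * ((θ : ℂ) - Real.pi / 2)))
        - (s + 1) * (s + 2) * (((Real.sin θ ^ s : ℝ) : ℂ) *
          Complex.exp (Complex.I * y * ((θ : ℂ) - Real.pi / 2)))) θ := by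
      intro θ hθ
      rw [uIcc_of_le Real.pi_pos.le] at hθ
      have hsin := Real.sin_nonneg_of_mem_Icc hθ
      have h1 := ((Real.hasDerivAt_sin θ).rpow_const (p := s + 2)
        (Or.inr (by linarith))).ofReal_comp
      have h2 := ((Real.hasDerivAt_sin θ).rpow_const (p := s + 1)
        (Or.inr (by linarith))).ofReal_comp
      have h3 := (Real.hasDerivAt_cos θ).ofReal_comp
      have h4 : HasDerivAt (fun θ : ℝ => Complex.exp (Complex.I * y * ((θ : ℂ) - Real.pi / 2)))
          (Complex.exp (Complex.I * y * ((θ : ℂ) - Real.pi / 2)) * (Complex.I * y * 1)) θ :=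
        (((hasDerivAt_id θ).ofReal_comp.sub_const _).const_mul (Complex.I * y)).cexp
      convert! ((h1.const_mul (Complex.I * y)).sub ((h2.mul h3).const_mul ((s : ℂ) + 2))).mul h4
        using 1
      have e1 : Real.sin θ ^ (s + 2 - 1) = Real.sin θ ^ s * Real.sin θ := by
        rw [show s + 2 - 1 = s + 1 by ring, Real.rpow_add_one' hsin (by linarith)]
      have e2 : Real.sin θ ^ (s + 1 - 1) = Real.sin θ ^ s := by rw [add_sub_cancel_right]
      have e3 : Real.sin θ ^ (s + 1) = Real.sin θ ^ s * Real.sin θ :=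
        Real.rpow_add_one' hsin (by linarith)
      have e4 : Real.sin θ ^ (s + 2) = Real.sin θ ^ s * Real.sin θ * Real.sin θ := by
        rw [show s + 2 = s + 1 + 1 by ring, Real.rpow_add_one' hsin (by linarith), e3]
      have hcs : (Real.cos θ : ℂ) ^ 2 = 1 - (Real.sin θ : ℂ) ^ 2 := by
        have := Real.cos_sq' θ
        exact_mod_cast congrArg (Complex.ofReal) this
      simp only [Pi.sub_apply, Pi.mul_apply, Complex.ofReal_mul, e1, e2, e3, e4, Complex.ofReal_add,
        Complex.ofReal_one,
        Complex.ofReal_ofNat, Complex.ofReal_neg]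
      linear_combination (exp := 1)
        (-((s : ℂ) + 1) * (s + 2) * ((Real.sin θ ^ s : ℝ) : ℂ) *
          Complex.exp (Complex.I * y * ((θ : ℂ) - Real.pi / 2))) * (- hcs)
        + (-(y ^ 2) * ((Real.sin θ ^ s : ℝ) : ℂ) * (Real.sin θ : ℂ) ^ 2 *
          Complex.exp (Complex.I * y * ((θ : ℂ) - Real.pi / 2))) * Complex.I_sq
    rw [intervalIntegral.integral_eq_sub_of_hasDerivAt hderiv]
    · have h0 : (0 : ℝ) ^ (s + 2) = 0 := Real.zero_rpow (by linarith)
      have h1 : (0 : ℝ) ^ (s + 1) = 0 := Real.zero_rpow (by linarith)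
      simp [h0, h1]
    · exact (((continuous_sinExp (s := s + 2) (by linarith) y).const_mul _).sub
        ((continuous_sinExp (s := s) (by linarith) y).const_mul _)).intervalIntegrable _ _
  rw [intervalIntegral.integral_sub, intervalIntegral.integral_const_mul,
    intervalIntegral.integral_const_mul, sub_eq_zero] at key
  · exact key
  · exact ((continuous_sinExp (s := s + 2) (by linarith) y).const_mul _).intervalIntegrable _ _
  · exact ((continuous_sinExp (s := s) (by linarith) y).const_mul _).intervalIntegrable _ _

theorem sinExpIntegral_zero_right (s : ℝ) :
    sinExpIntegral s 0 = ((∫ θ in (0 : ℝ)..Real.pi, Real.sin θ ^ s : ℝ) : ℂ) := by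
  simp [sinExpIntegral, intervalIntegral.integral_ofReal]

theorem integral_sin_rpow_add_two {s : ℝ} (hs : 1 ≤ s) :
    (s + 2) * ∫ θ in (0 : ℝ)..Real.pi, Real.sin θ ^ (s + 2)
      = (s + 1) * ∫ θ in (0 : ℝ)..Real.pi, Real.sin θ ^ s := by
  have h := sinExpIntegral_add_two hs 0
  rw [sinExpIntegral_zero_right, sinExpIntegral_zero_right] at h
  have h' : ((s + 2) ^ 2 - 0 ^ 2) * ∫ θ in (0 : ℝ)..Real.pi, Real.sin θ ^ (s + 2)
      = (s + 1) * (s + 2) * ∫ θ in (0 : ℝ)..Real.pi, Real.sin θ ^ s := by exact_mod_cast h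
  have : s + 2 ≠ 0 := by linarith
  apply mul_left_cancel₀ this
  linear_combination h'

theorem integral_sin_rpow_pos {s : ℝ} (hs : 0 ≤ s) :
    0 < ∫ θ in (0 : ℝ)..Real.pi, Real.sin θ ^ s := by
  apply intervalIntegral.intervalIntegral_pos_of_pos_on
    ((continuous_sin_rpow hs).intervalIntegrable _ _) _ Real.pi_pos
  intro θ hθ
  exact Real.rpow_pos_of_pos (Real.sin_pos_of_mem_Ioo hθ) _

/-- As s grows, sin^s concentrates at π/2, where the exponential is 1. The deviation is O(|cos θ|),
and the mean of cos² under the weight sin^s is 1/(s+2). -/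
theorem norm_sinExpIntegral_sub_le (y : ℂ) : ∃ C : ℝ, ∀ s : ℝ, 1 ≤ s →
    ‖sinExpIntegral s y - sinExpIntegral s 0‖
      ≤ C / Real.sqrt (s + 2) * ∫ θ in (0 : ℝ)..Real.pi, Real.sin θ ^ s := by
  set K : ℝ := ‖y‖ * Real.exp (‖y‖ * (Real.pi / 2)) * (Real.pi / 2) with hK
  have hK0 : 0 ≤ K := by have := Real.pi_pos; positivity
  have hbound : ∀ θ ∈ Icc 0 Real.pi,
      ‖Complex.exp (Complex.I * y * ((θ : ℂ) - Real.pi / 2)) - 1‖ ≤ K * |Real.cos θ| := by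
    intro θ hθ
    have h1 : |θ - Real.pi / 2| ≤ Real.pi / 2 := by
      rw [abs_le]; constructor <;> linarith [hθ.1, hθ.2]
    have h2 := Real.mul_abs_le_abs_sin h1
    rw [Real.sin_sub_pi_div_two, abs_neg] at h2
    -- Jordan's inequality turns the distance to π/2 into |cos θ|.
    have h3 : |θ - Real.pi / 2| ≤ Real.pi / 2 * |Real.cos θ| := by
      have hp := Real.pi_pos
      calc |θ - Real.pi / 2| = Real.pi / 2 * (2 / Real.pi * |θ - Real.pi / 2|) := by field_simp
        _ ≤ _ := by gcongr
    have h4 : ‖Complex.I * y * ((θ : ℂ) - Real.pi / 2)‖ = ‖y‖ * |θ - Real.pi / 2| := by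
      rw [norm_mul, norm_mul, Complex.norm_I, one_mul]
      congr 1
      rw [← Real.norm_eq_abs, ← Complex.norm_real]
      push_cast; rfl
    calc _ ≤ ‖Complex.I * y * ((θ : ℂ) - Real.pi / 2)‖
          * Real.exp ‖Complex.I * y * ((θ : ℂ) - Real.pi / 2)‖ := by
            simpa using Complex.norm_exp_sub_sum_le_norm_mul_exp
              (Complex.I * y * ((θ : ℂ) - Real.pi / 2)) 1
      _ ≤ (‖y‖ * (Real.pi / 2 * |Real.cos θ|)) * Real.exp (‖y‖ * (Real.pi / 2)) := by
            rw [h4]; gcongr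
      _ = _ := by rw [hK]; ring
  refine ⟨K, fun s hs => ?_⟩
  have hs2 : 0 < s + 2 := by linarith
  set r := Real.sqrt (s + 2) with hr
  have hr0 : 0 < r := Real.sqrt_pos.2 hs2
  have hrr : r * r = s + 2 := Real.mul_self_sqrt hs2.le
  have hi1 := (continuous_sin_rpow (s := s) (by linarith)).intervalIntegrable
    (μ := volume) 0 Real.pi
  have hi2 := (continuous_sin_rpow (s := s + 2) (by linarith)).intervalIntegrable
    (μ := volume) 0 Real.pi
  calc ‖sinExpIntegral s y - sinExpIntegral s 0‖
      ≤ ∫ θ in (0 : ℝ)..Real.pi, K / 2 * ((1 / r + r) * Real.sin θ ^ s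
          - r * Real.sin θ ^ (s + 2)) := by
        rw [sinExpIntegral, sinExpIntegral, ← intervalIntegral.integral_sub
          ((continuous_sinExp (by linarith) y).intervalIntegrable _ _)
          ((continuous_sinExp (by linarith) 0).intervalIntegrable _ _)]
        apply intervalIntegral.norm_integral_le_of_norm_le Real.pi_pos.le
        · refine Eventually.of_forall fun θ hθ => ?_
          have hθ' : θ ∈ Icc 0 Real.pi := ⟨hθ.1.le, hθ.2⟩
          have hsin := Real.sin_nonneg_of_mem_Icc hθ'
          have hsp : 0 ≤ Real.sin θ ^ s := Real.rpow_nonneg hsin _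
          have e4 : Real.sin θ ^ (s + 2) = Real.sin θ ^ s * Real.sin θ ^ 2 := by
            rw [Real.rpow_add' hsin (by linarith)]; norm_num
          -- Arithmetic-geometric mean inequality with weight r = √(s+2), chosen so that both terms
          -- contribute 1/r after integration.
          have hcos : |Real.cos θ| ≤ 1 / 2 * (1 / r + r * (1 - Real.sin θ ^ 2)) := by
            rw [← Real.cos_sq', ← sq_abs (Real.cos θ)]
            have : 0 ≤ (1 - r * |Real.cos θ|) ^ 2 / r := by positivity
            have e : (1 - r * |Real.cos θ|) ^ 2 / r
              = 1 / r + r * |Real.cos θ| ^ 2 - 2 * |Real.cos θ| := by field_simp; ring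
            rw [e] at this
            linarith
          have : ((Real.sin θ ^ s : ℝ) : ℂ) * Complex.exp (Complex.I * y * ((θ : ℂ) - Real.pi / 2))
              - ((Real.sin θ ^ s : ℝ) : ℂ)
                * Complex.exp (Complex.I * 0 * ((θ : ℂ) - Real.pi / 2))
              = ((Real.sin θ ^ s : ℝ) : ℂ)
                * (Complex.exp (Complex.I * y * ((θ : ℂ) - Real.pi / 2)) - 1) := by simp; ring
          rw [this, norm_mul, Complex.norm_real, Real.norm_of_nonneg hsp, e4]
          calc Real.sin θ ^ s * ‖Complex.exp (Complex.I * y * ((θ : ℂ) - Real.pi / 2)) - 1‖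
              ≤ Real.sin θ ^ s * (K * (1 / 2 * (1 / r + r * (1 - Real.sin θ ^ 2)))) := by
                gcongr
                exact (hbound θ hθ').trans (by gcongr)
            _ = _ := by ring
        · exact ((hi1.const_mul _).sub (hi2.const_mul _)).const_mul _
    _ = K / 2 * ((1 / r + r) * (∫ θ in (0 : ℝ)..Real.pi, Real.sin θ ^ s)
          - r * ∫ θ in (0 : ℝ)..Real.pi, Real.sin θ ^ (s + 2)) := by
        rw [intervalIntegral.integral_const_mul, intervalIntegral.integral_sub
          (hi1.const_mul _) (hi2.const_mul _), intervalIntegral.integral_const_mul,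
          intervalIntegral.integral_const_mul]
    _ = _ := by
        have h := integral_sin_rpow_add_two hs
        have : (∫ θ in (0 : ℝ)..Real.pi, Real.sin θ ^ (s + 2))
            = (s + 1) / (r * r) * ∫ θ in (0 : ℝ)..Real.pi, Real.sin θ ^ s := by
          rw [hrr]; field_simp; linarith
        rw [this]
        have hs1 : s + 1 = r * r - 1 := by linarith
        rw [hs1]
        field_simp
        ring

theorem Complex.Gamma_add_natCast_eq (z : ℂ) (hz : ∀ i : ℕ, z + i ≠ 0) (n : ℕ) :
    Complex.Gamma (z + n) = Complex.Gamma z * ∏ i ∈ Finset.range n, (z + i) := by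
  induction n with
  | zero => simp
  | succ n ih =>
    rw [Finset.prod_range_succ, Nat.cast_succ, ← add_assoc, Complex.Gamma_add_one _ (hz n), ih]
    ring

/-- Euler's limit: Γ(z+j+1) = Γ(z) j^z j! / `GammaSeq z j`, and the powers j^{±w} and the factorials
cancel in the symmetric quotient. -/
theorem tendsto_Gamma_ratio {a w : ℂ} (h1 : |w.re| < a.re) :
    Tendsto (fun j : ℕ => Complex.Gamma (a + w + j) * Complex.Gamma (a - w + j)
      / Complex.Gamma (a + j) ^ 2) atTop (𝓝 1) := by
  have hne : ∀ z : ℂ, 0 < z.re → ∀ i : ℕ, z + i ≠ 0 := by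
    intro z hz i h
    have := congrArg Complex.re h
    simp at this
    have : (0 : ℝ) ≤ i := Nat.cast_nonneg i
    linarith
  have ha : 0 < a.re := (abs_nonneg _).trans_lt h1
  have hp : 0 < (a + w).re := by rw [Complex.add_re]; linarith [neg_abs_le w.re]
  have hm : 0 < (a - w).re := by rw [Complex.sub_re]; linarith [le_abs_self w.re]
  have hG : ∀ z : ℂ, 0 < z.re → Complex.Gamma z ≠ 0 :=
    fun z hz => Complex.Gamma_ne_zero_of_re_pos hz
  have hlim : Tendsto (fun j : ℕ => Complex.Gamma (a + w) * Complex.Gamma (a - w)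
      / Complex.Gamma a ^ 2 * (Complex.GammaSeq a j ^ 2
        / (Complex.GammaSeq (a + w) j * Complex.GammaSeq (a - w) j))) atTop
      (𝓝 (Complex.Gamma (a + w) * Complex.Gamma (a - w) / Complex.Gamma a ^ 2
        * (Complex.Gamma a ^ 2 / (Complex.Gamma (a + w) * Complex.Gamma (a - w))))) := by
    refine Tendsto.const_mul _ (Tendsto.div ((Complex.GammaSeq_tendsto_Gamma a).pow 2)
      ((Complex.GammaSeq_tendsto_Gamma _).mul (Complex.GammaSeq_tendsto_Gamma _)) ?_)
    exact mul_ne_zero (hG _ hp) (hG _ hm)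
  have hone : Complex.Gamma (a + w) * Complex.Gamma (a - w) / Complex.Gamma a ^ 2
        * (Complex.Gamma a ^ 2 / (Complex.Gamma (a + w) * Complex.Gamma (a - w))) = 1 := by
    have := hG _ ha; have := hG _ hp; have := hG _ hm
    field_simp
  rw [hone] at hlim
  refine (tendsto_add_atTop_iff_nat 1).1 (hlim.congr' ?_)
  filter_upwards [eventually_ne_atTop 0] with j hj
  have hj' : (j : ℂ) ≠ 0 := Nat.cast_ne_zero.2 hj
  rw [Complex.Gamma_add_natCast_eq _ (hne _ hp), Complex.Gamma_add_natCast_eq _ (hne _ hm),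
    Complex.Gamma_add_natCast_eq _ (hne _ ha), Complex.GammaSeq, Complex.GammaSeq,
    Complex.GammaSeq, Complex.cpow_add _ _ hj', Complex.cpow_sub _ _ hj']
  have p1 : (∏ i ∈ Finset.range (j + 1), (a + i)) ≠ 0 :=
    Finset.prod_ne_zero_iff.2 fun i _ => hne _ ha i
  have p2 : (∏ i ∈ Finset.range (j + 1), (a + w + i)) ≠ 0 :=
    Finset.prod_ne_zero_iff.2 fun i _ => hne _ hp i
  have p3 : (∏ i ∈ Finset.range (j + 1), (a - w + i)) ≠ 0 :=
    Finset.prod_ne_zero_iff.2 fun i _ => hne _ hm i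
  have g1 := hG _ ha
  have c1 : (j : ℂ) ^ a ≠ 0 := by simp [Complex.cpow_eq_zero_iff, hj]
  have c2 : (j : ℂ) ^ w ≠ 0 := by simp [Complex.cpow_eq_zero_iff, hj]
  have c3 : ((j.factorial : ℕ) : ℂ) ≠ 0 := Nat.cast_ne_zero.2 j.factorial_ne_zero
  field_simp

theorem tendsto_sinExpIntegral_ratio {s : ℝ} (hs : 1 ≤ s) (y : ℂ) :
    Tendsto (fun j : ℕ => sinExpIntegral (s + 2 * j) y / sinExpIntegral (s + 2 * j) 0)
      atTop (𝓝 1) := by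
  obtain ⟨C, hC⟩ := norm_sinExpIntegral_sub_le y
  rw [tendsto_iff_norm_sub_tendsto_zero]
  refine squeeze_zero (g := fun j : ℕ => C / Real.sqrt (s + 2 * j + 2)) (fun _ => norm_nonneg _)
    (fun j => ?_) ?_
  · have hsj : 1 ≤ s + 2 * (j : ℝ) := by have : (0 : ℝ) ≤ j := Nat.cast_nonneg j; linarith
    have hpos := integral_sin_rpow_pos (s := s + 2 * (j : ℝ)) (by linarith)
    have h := hC _ hsj
    have hne : sinExpIntegral (s + 2 * (j : ℝ)) 0 ≠ 0 := by
      rw [sinExpIntegral_zero_right]; exact_mod_cast hpos.ne'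
    rw [div_sub_one hne, norm_div]
    conv_lhs => rw [sinExpIntegral_zero_right]
    rw [Complex.norm_real, Real.norm_of_nonneg hpos.le, div_le_iff₀ hpos,
      ← sinExpIntegral_zero_right]
    exact h
  · apply Tendsto.const_div_atTop
    apply Real.tendsto_sqrt_atTop.comp
    apply tendsto_atTop_add_const_right
    apply tendsto_atTop_add_const_left
    exact tendsto_natCast_atTop_atTop.const_mul_atTop (by norm_num)

/-- Both the integral and the Gamma product obey the same recurrence under s ↦ s+2, so their
normalized quotient `q` is constant along s+2j; its limit is 1. -/
theorem sinExpIntegral_mul_Gamma {s : ℝ} (hs : 1 ≤ s) {y : ℂ} (hy : |y.re| < s + 2) :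
    sinExpIntegral s y * (Complex.Gamma (((s : ℂ) + 2 + y) / 2)
        * Complex.Gamma (((s : ℂ) + 2 - y) / 2))
      = sinExpIntegral s 0 * Complex.Gamma (((s : ℂ) + 2) / 2) ^ 2 := by
  set a : ℂ := ((s : ℂ) + 2) / 2 with ha
  set w : ℂ := y / 2 with hw
  have hare : a.re = (s + 2) / 2 := by
    rw [ha, show ((s : ℂ) + 2) / 2 = (((s + 2) / 2 : ℝ) : ℂ) by push_cast; rfl, Complex.ofReal_re]
  have hwre : w.re = y.re / 2 := by rw [hw]; simp
  have h1 : |w.re| < a.re := by rw [hare, hwre, abs_div, abs_two]; linarith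
  have hsj : ∀ j : ℕ, 1 ≤ s + 2 * (j : ℝ) := fun j => by
    have : (0 : ℝ) ≤ j := Nat.cast_nonneg j
    linarith
  have hW0 : ∀ j : ℕ, sinExpIntegral (s + 2 * (j : ℝ)) 0 ≠ 0 := fun j => by
    rw [sinExpIntegral_zero_right]
    exact_mod_cast (integral_sin_rpow_pos (by linarith [hsj j])).ne'
  have hre : ∀ (u : ℂ), |u.re| < a.re → ∀ j : ℕ, 0 < (a + u + j).re := fun u hu j => by
    have : (0 : ℝ) ≤ j := Nat.cast_nonneg j
    simp only [Complex.add_re, Complex.natCast_re]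
    linarith [neg_abs_le u.re]
  have hre0 : ∀ (u : ℂ), |u.re| < a.re → ∀ j : ℕ, a + u + j ≠ 0 := fun u hu j h => by
    have := hre u hu j; rw [h] at this; simp at this
  have hm : |(-w).re| < a.re := by simpa using h1
  have h00 : |(0 : ℂ).re| < a.re := by simpa using (abs_nonneg _).trans_lt h1
  have hG0 : ∀ j : ℕ, Complex.Gamma (a + j) ≠ 0 := fun j =>
    Complex.Gamma_ne_zero_of_re_pos (by simpa using hre 0 h00 j)
  set q : ℕ → ℂ := fun j => sinExpIntegral (s + 2 * j) y / sinExpIntegral (s + 2 * j) 0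
    * (Complex.Gamma (a + w + j) * Complex.Gamma (a - w + j) / Complex.Gamma (a + j) ^ 2) with hq
  have hstep : ∀ j, q (j + 1) = q j := by
    intro j
    have r1 := sinExpIntegral_add_two (hsj j) y
    have r2 := sinExpIntegral_add_two (hsj j) 0
    have e : s + 2 * ((j + 1 : ℕ) : ℝ) = s + 2 * j + 2 := by push_cast; ring
    have gp := Complex.Gamma_add_one _ (hre0 w h1 j)
    have gm := Complex.Gamma_add_one _ (hre0 (-w) hm j)
    have g0 := Complex.Gamma_add_one (a + j) (by simpa using hre0 0 h00 j)
    rw [← sub_eq_add_neg] at gm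
    simp only [hq, e]
    have hWn := hW0 (j + 1)
    rw [e] at hWn
    have hW := hW0 j
    have hGj := hG0 j
    have hGn := hG0 (j + 1)
    push_cast at hGn ⊢
    rw [← add_assoc] at hGn
    simp only [← add_assoc]
    rw [gp, gm, g0]
    rw [g0] at hGn
    have haj : a + j ≠ 0 := left_ne_zero_of_mul hGn
    rw [div_mul_div_comm, div_mul_div_comm, div_eq_div_iff
      (mul_ne_zero hWn (pow_ne_zero 2 hGn)) (mul_ne_zero hW (pow_ne_zero 2 hGj))]
    have ea : (s : ℂ) = 2 * a - 2 := by rw [ha]; ring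
    have ey : y = 2 * w := by rw [hw]; ring
    push_cast at r1 r2
    rw [ea, ey] at r1
    rw [ea] at r2
    rw [ey]
    have r1' : sinExpIntegral (s + 2 * j + 2) (2 * w) * ((a + w + j) * (a - w + j)) * 4
        = (2 * a - 2 + 2 * j + 1) * (2 * a - 2 + 2 * j + 2)
          * sinExpIntegral (s + 2 * j) (2 * w) := by linear_combination r1
    have r2' : sinExpIntegral (s + 2 * j + 2) 0 * (a + j) ^ 2 * 4
        = (2 * a - 2 + 2 * j + 1) * (2 * a - 2 + 2 * j + 2) * sinExpIntegral (s + 2 * j) 0 := by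
      linear_combination r2
    have hx : sinExpIntegral (s + 2 * j + 2) (2 * w) * ((a + w + j) * (a - w + j))
          * sinExpIntegral (s + 2 * j) 0
        = sinExpIntegral (s + 2 * j) (2 * w) * (sinExpIntegral (s + 2 * j + 2) 0 * (a + j) ^ 2) := by
      linear_combination (1 / 4) * sinExpIntegral (s + 2 * j) 0 * r1'
        - (1 / 4) * sinExpIntegral (s + 2 * j) (2 * w) * r2'
    linear_combination (Complex.Gamma (a + w + j) * Complex.Gamma (a - w + j)
      * Complex.Gamma (a + j) ^ 2) * hx
  have hconst : ∀ j, q j = q 0 := fun j => by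
    induction j with
    | zero => rfl
    | succ j ih => rw [hstep, ih]
  have hlim : Tendsto q atTop (𝓝 1) := by
    have := (tendsto_sinExpIntegral_ratio hs y).mul (tendsto_Gamma_ratio h1)
    rwa [one_mul] at this
  have hq0 : q 0 = 1 :=
    tendsto_nhds_unique (tendsto_const_nhds.congr fun j => (hconst j).symm) hlim
  have hw0 := hW0 0
  have hg0 := hG0 0
  simp only [hq, Nat.cast_zero, mul_zero, add_zero] at hq0 hw0 hg0
  rw [show ((s : ℂ) + 2 + y) / 2 = a + w by rw [ha, hw]; ring,
    show ((s : ℂ) + 2 - y) / 2 = a - w by rw [ha, hw]; ring]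
  field_simp at hq0
  linear_combination hq0

/-- The substitution t = (1 - cos θ)/2 gives the Beta integral at ((s+1)/2, (s+1)/2), and Legendre's
duplication formula simplifies it. -/
theorem integral_sin_rpow_eq {s : ℝ} (hs : 1 ≤ s) :
    sinExpIntegral s 0 * Complex.Gamma (((s : ℂ) + 2) / 2) ^ 2
      = Real.pi * ((2 : ℝ) ^ (-s) : ℝ) * Complex.Gamma (s + 1) := by
  have hu : 0 < (((s + 1) / 2 : ℝ) : ℂ).re := by rw [Complex.ofReal_re]; linarith
  have hbeta := Complex.Gamma_mul_Gamma_eq_betaIntegral hu hu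
  have hdup := Complex.Gamma_mul_Gamma_add_half (((s + 1) / 2 : ℝ) : ℂ)
  have hbi : Complex.betaIntegral (((s + 1) / 2 : ℝ) : ℂ) (((s + 1) / 2 : ℝ) : ℂ)
      = ((2 : ℝ) ^ (-s) : ℝ) * sinExpIntegral s 0 := by
    have hr : Complex.betaIntegral (((s + 1) / 2 : ℝ) : ℂ) (((s + 1) / 2 : ℝ) : ℂ)
        = ((∫ t in (0 : ℝ)..1, t ^ ((s - 1) / 2) * (1 - t) ^ ((s - 1) / 2) : ℝ) : ℂ) := by
      rw [Complex.betaIntegral, ← intervalIntegral.integral_ofReal]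
      apply intervalIntegral.integral_congr
      intro t ht
      rw [uIcc_of_le zero_le_one] at ht
      simp only
      push_cast
      rw [Complex.ofReal_cpow ht.1, Complex.ofReal_cpow (by linarith [ht.2])]
      push_cast
      congr 2 <;> ring
    have hsub := intervalIntegral.integral_comp_mul_deriv (a := 0) (b := Real.pi)
      (f := fun θ => (1 - Real.cos θ) / 2) (f' := fun θ => Real.sin θ / 2)
      (g := fun t : ℝ => t ^ ((s - 1) / 2) * (1 - t) ^ ((s - 1) / 2))
      (fun θ _ => by simpa using ((Real.hasDerivAt_cos θ).const_sub 1).div_const 2)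
      (by fun_prop)
      ((continuous_id.rpow_const fun _ => Or.inr (by linarith)).mul
        ((continuous_const.sub continuous_id).rpow_const fun _ => Or.inr (by linarith)))
    rw [hr, sinExpIntegral_zero_right, ← Complex.ofReal_mul, ← intervalIntegral.integral_const_mul]
    simp only [Real.cos_zero, Real.cos_pi] at hsub
    norm_num at hsub
    rw [← hsub]
    congr 1
    apply intervalIntegral.integral_congr
    intro θ hθ
    rw [uIcc_of_le Real.pi_pos.le] at hθ
    have hsin := Real.sin_nonneg_of_mem_Icc hθ
    have hc := Real.neg_one_le_cos θ
    have hc' := Real.cos_le_one θ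
    simp only
    rw [← Real.mul_rpow (by linarith) (by linarith)]
    have e : (1 - Real.cos θ) / 2 * (1 - (1 - Real.cos θ) / 2) = (Real.sin θ / 2) ^ (2 : ℝ) := by
      rw [Real.rpow_two]
      have := Real.sin_sq_add_cos_sq θ
      linear_combination (-1 / 4) * this
    rw [e, ← Real.rpow_mul (by positivity), ← Real.rpow_add_one' (by positivity) (by linarith),
      Real.div_rpow hsin (by norm_num), Real.rpow_neg (by norm_num),
      show 2 * ((s - 1) / 2) + 1 = s by ring]
    field_simp
  rw [hbi] at hbeta
  have ha : (((s + 1) / 2 : ℝ) : ℂ) + 1 / 2 = ((s : ℂ) + 2) / 2 := by push_cast; ring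
  have hb : 2 * (((s + 1) / 2 : ℝ) : ℂ) = (s : ℂ) + 1 := by push_cast; ring
  have hb' : (((s + 1) / 2 : ℝ) : ℂ) + (((s + 1) / 2 : ℝ) : ℂ) = (s : ℂ) + 1 := by push_cast; ring
  have h2 : (2 : ℂ) ^ (1 - ((s : ℂ) + 1)) = ((2 : ℝ) ^ (-s) : ℝ) := by
    rw [Complex.ofReal_cpow (by norm_num)]
    push_cast
    congr 1; ring
  rw [ha, hb, h2] at hdup
  rw [hb'] at hbeta
  have hG1 : Complex.Gamma ((s : ℂ) + 1) ≠ 0 := by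
    apply Complex.Gamma_ne_zero_of_re_pos
    rw [Complex.add_re, Complex.ofReal_re, Complex.one_re]; linarith
  have h2ne : (((2 : ℝ) ^ (-s) : ℝ) : ℂ) ≠ 0 := by
    exact_mod_cast (Real.rpow_pos_of_pos (by norm_num : (0 : ℝ) < 2) (-s)).ne'
  have hpi : ((Real.sqrt Real.pi : ℝ) : ℂ) ^ 2 = Real.pi := by
    exact_mod_cast congrArg Complex.ofReal (Real.sq_sqrt Real.pi_pos.le)
  apply mul_left_cancel₀ (mul_ne_zero hG1 h2ne)
  rw [← hpi]
  calc _ = (Complex.Gamma ((s : ℂ) + 1) * (((2 : ℝ) ^ (-s) : ℝ) * sinExpIntegral s 0))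
        * Complex.Gamma (((s : ℂ) + 2) / 2) ^ 2 := by ring
    _ = (Complex.Gamma (((s + 1) / 2 : ℝ) : ℂ) * Complex.Gamma (((s : ℂ) + 2) / 2)) ^ 2 := by
        rw [← hbeta]; ring
    _ = _ := by rw [hdup]; ring

/-- Cauchy's integral `∫_0^π sin^s θ exp(i y (θ - π/2)) dθ`. -/
theorem sinExpIntegral_eq {s : ℝ} (hs : 1 ≤ s) {y : ℂ} (hy : |y.re| < s + 2) :
    sinExpIntegral s y = Real.pi * ((2 : ℝ) ^ (-s) : ℝ) * Complex.Gamma (s + 1)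
      / (Complex.Gamma (((s : ℂ) + 2 + y) / 2) * Complex.Gamma (((s : ℂ) + 2 - y) / 2)) := by
  rw [eq_div_iff, sinExpIntegral_mul_Gamma hs hy, integral_sin_rpow_eq hs]
  have hre : ∀ u : ℂ, |u.re| < s + 2 → 0 < (((s : ℂ) + 2 + u) / 2).re := fun u hu => by
    have : (((s : ℂ) + 2 + u) / 2).re = (s + 2 + u.re) / 2 := by simp
    rw [this]
    linarith [neg_abs_le u.re]
  refine mul_ne_zero (Complex.Gamma_ne_zero_of_re_pos (hre y hy)) ?_
  rw [sub_eq_add_neg]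
  exact Complex.Gamma_ne_zero_of_re_pos (hre (-y) (by simpa using hy))

/-! ### Jacobi polynomials with arbitrary complex parameters -/

open Polynomial in
/-- The Jacobi polynomial as a polynomial in the variable `(z - 1) / 2`. -/
def jacobiShifted (n : ℕ) (a b : ℂ) : ℂ[X] :=
  ∑ k ∈ Finset.range (n + 1),
    C ((ascPochhammer ℂ k).eval (n + a + b + 1) * (ascPochhammer ℂ (n - k)).eval (a + k + 1)
      / ((k.factorial : ℂ) * ((n - k).factorial : ℂ))) * X ^ k

theorem jacobiShifted_eval (n : ℕ) (a b z : ℂ) :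
    (jacobiShifted n a b).eval ((z - 1) / 2) = jacobiP n a b z := by
  simp [jacobiShifted, jacobiP, Polynomial.eval_finsetSum]

theorem jacobiShifted_coeff (n : ℕ) (a b : ℂ) (k : ℕ) :
    (jacobiShifted n a b).coeff k = if k ≤ n then
      (ascPochhammer ℂ k).eval (n + a + b + 1) * (ascPochhammer ℂ (n - k)).eval (a + k + 1)
      / ((k.factorial : ℂ) * ((n - k).factorial : ℂ)) else 0 := by
  simp only [jacobiShifted, Polynomial.finsetSum_coeff, Polynomial.coeff_C_mul,
    Polynomial.coeff_X_pow, mul_ite, mul_one, mul_zero, Finset.sum_ite_eq, Finset.mem_range,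
    Nat.lt_succ_iff]

theorem ascPochhammer_eval_succ_left (n : ℕ) (z : ℂ) :
    (ascPochhammer ℂ (n + 1)).eval z = z * (ascPochhammer ℂ n).eval (z + 1) := by
  simp [ascPochhammer_succ_left]

/-- The hypergeometric recurrence, kept free of division so that it holds even where a+k+1 = 0 and
beyond the top index; it is the differential equation read coefficientwise. -/
theorem jacobiShifted_coeff_succ (n : ℕ) (a b : ℂ) (k : ℕ) :
    ((k : ℂ) + 1) * (a + k + 1) * (jacobiShifted n a b).coeff (k + 1)
      = (n + a + b + 1 + k) * ((n : ℂ) - k) * (jacobiShifted n a b).coeff k := by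
  rw [jacobiShifted_coeff, jacobiShifted_coeff]
  rcases lt_trichotomy k n with h | h | h
  · obtain ⟨d, rfl⟩ := Nat.exists_eq_add_of_lt h
    rw [if_pos (by omega), if_pos (by omega), show k + d + 1 - (k + 1) = d by omega,
      show k + d + 1 - k = d + 1 by omega, ascPochhammer_succ_eval, ascPochhammer_eval_succ_left,
      Nat.factorial_succ, Nat.factorial_succ]
    have h1 : ((k.factorial : ℕ) : ℂ) ≠ 0 := Nat.cast_ne_zero.2 k.factorial_ne_zero
    have h2 : ((d.factorial : ℕ) : ℂ) ≠ 0 := Nat.cast_ne_zero.2 d.factorial_ne_zero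
    have h3 : ((k : ℂ) + 1) ≠ 0 := Nat.cast_add_one_ne_zero k
    have h4 : ((d : ℂ) + 1) ≠ 0 := Nat.cast_add_one_ne_zero d
    push_cast
    rw [show a + ((k : ℂ) + 1) + 1 = a + k + 1 + 1 by ring]
    field_simp
    ring
  · subst h; simp
  · rw [if_neg (by omega), if_neg (by omega)]; simp

open Polynomial in
/-- The Jacobi differential equation. -/
theorem jacobiShifted_ode (n : ℕ) (a b : ℂ) :
    X * (X + 1) * derivative (derivative (jacobiShifted n a b))
      + (C (a + b + 2) * X + C (a + 1)) * derivative (jacobiShifted n a b)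
      = C ((n : ℂ) * (n + a + b + 1)) * jacobiShifted n a b := by
  have hrw : X * (X + 1) * derivative (derivative (jacobiShifted n a b))
      + (C (a + b + 2) * X + C (a + 1)) * derivative (jacobiShifted n a b)
      = X * (X * derivative (derivative (jacobiShifted n a b)))
        + X * derivative (derivative (jacobiShifted n a b))
        + C (a + b + 2) * (X * derivative (jacobiShifted n a b))
        + C (a + 1) * derivative (jacobiShifted n a b) := by ring
  rw [hrw]
  ext k
  have h := jacobiShifted_coeff_succ n a b k
  rcases k with _ | _ | k
  · simp only [coeff_add, mul_coeff_zero, coeff_X_zero, coeff_C_zero, coeff_derivative]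
    push_cast at h ⊢
    linear_combination h
  · simp only [coeff_add, coeff_C_mul, coeff_X_mul, mul_coeff_zero, coeff_X_zero,
      coeff_derivative]
    push_cast at h ⊢
    linear_combination h
  · simp only [coeff_add, coeff_C_mul, coeff_X_mul, coeff_derivative]
    push_cast at h ⊢
    linear_combination h

/-! ### The ladder operators as operators on polynomials in the cotangent -/

namespace PoschlTeller

open Polynomial

variable (p : PoschlTeller)

/-- The exponent `n + ν + 1`. -/
def expo (n : ℕ) : ℝ := n + p.ν + 1

/-- The energy `E_n` in units of `ε₀`. -/
def redEnergy (n : ℕ) : ℝ := p.expo n ^ 2 - (p.β / p.expo n) ^ 2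

/-- The logarithmic derivative of the ground state of level `k`, as a polynomial in the
cotangent. -/
def groundPoly (k : ℕ) : ℂ[X] := C (p.expo k : ℂ) * X - C ((p.β / p.expo k : ℝ) : ℂ)

/-- The action of the derivative on `sin^{n+ν+1} exp(-β · / (n+ν+1)) R(cot)`. -/
def derivPoly (n : ℕ) (R : ℂ[X]) : ℂ[X] := p.groundPoly n * R - (1 + X ^ 2) * derivative R

/-- The action of `A_k`, up to a constant factor. -/
def raisePoly (n k : ℕ) (R : ℂ[X]) : ℂ[X] := p.derivPoly n R - p.groundPoly k * R

/-- The action of `A_k†`, up to a constant factor. -/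
def lowerPoly (n k : ℕ) (R : ℂ[X]) : ℂ[X] := -p.derivPoly n R - p.groundPoly k * R

/-- The polynomial factor of `φ_n`. -/
def eigenPoly (n : ℕ) : ℂ[X] :=
  (jacobiShifted n (p.aParam n) (starRingEnd ℂ (p.aParam n))).comp
    (C (Complex.I / 2) * X - C (1 / 2))

/-- The polynomial factor of `A_{k-1} ⋯ A_0 φ_n`. -/
def hierPoly (n : ℕ) : ℕ → ℂ[X]
  | 0 => p.eigenPoly n
  | k + 1 => p.raisePoly n k (hierPoly n k)

variable {p}

theorem expo_pos (hν : 0 ≤ p.ν) (n : ℕ) : 0 < p.expo n := by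
  have : (0 : ℝ) ≤ n := Nat.cast_nonneg n
  unfold expo; linarith

theorem expo_succ (n : ℕ) : p.expo (n + 1) = p.expo n + 1 := by
  unfold expo; push_cast; ring

/-- Factorization of a Schrödinger operator: 1+X² stands for 1/sin², and for k = 0 the coefficient
`expo k * (expo k - 1)` is ν(ν+1), the original potential. -/
theorem lowerPoly_raisePoly (hν : 0 ≤ p.ν) (n k : ℕ) (R : ℂ[X]) :
    p.lowerPoly n k (p.raisePoly n k R) = -p.derivPoly n (p.derivPoly n R)
      + (C (p.expo k * (p.expo k - 1) : ℂ) * (1 + X ^ 2) - C (2 * p.β : ℂ) * X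
        - C (p.redEnergy k : ℂ)) * R := by
  have h : (C (p.expo k : ℂ)) * C ((p.β / p.expo k : ℝ) : ℂ) = C (p.β : ℂ) := by
    have := (expo_pos hν k).ne'
    rw [← C_mul, ← Complex.ofReal_mul, mul_div_cancel₀ _ this]
  simp only [lowerPoly, raisePoly, derivPoly, groundPoly, redEnergy, derivative_add,
    derivative_sub, derivative_mul, derivative_C, derivative_X, derivative_one, derivative_X_pow,
    Complex.ofReal_sub, Complex.ofReal_pow, C_sub, C_mul, C_pow, C_1, map_ofNat]
  linear_combination (-2 * X * R) * h

/-- Shape invariance: reversing the factors replaces e(e-1) by e(e+1), which is the coefficient for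
e+1, so only a constant remains. -/
theorem raisePoly_lowerPoly (hν : 0 ≤ p.ν) (n k : ℕ) (R : ℂ[X]) :
    p.raisePoly n k (p.lowerPoly n k R) = p.lowerPoly n (k + 1) (p.raisePoly n (k + 1) R)
      + C ((p.redEnergy (k + 1) - p.redEnergy k : ℝ) : ℂ) * R := by
  have h : (C (p.expo k : ℂ)) * C ((p.β / p.expo k : ℝ) : ℂ) = C (p.β : ℂ) := by
    have := (expo_pos hν k).ne'
    rw [← C_mul, ← Complex.ofReal_mul, mul_div_cancel₀ _ this]
  rw [lowerPoly_raisePoly hν, expo_succ]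
  simp only [lowerPoly, raisePoly, derivPoly, groundPoly, redEnergy, derivative_add,
    derivative_sub, derivative_mul, derivative_C, derivative_X, derivative_one, derivative_X_pow,
    Complex.ofReal_sub, Complex.ofReal_pow, Complex.ofReal_add, Complex.ofReal_one, C_sub, C_mul,
    C_pow, C_1, C_add, map_ofNat, derivative_neg]
  linear_combination (-2 * X * R) * h

theorem aParam_add_conj (n : ℕ) :
    p.aParam n + starRingEnd ℂ (p.aParam n) = -2 * (p.expo n : ℂ) := by
  simp only [aParam, expo, map_add, map_neg, map_div₀, map_mul, Complex.conj_ofReal,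
    Complex.conj_I, map_one, map_natCast]
  push_cast
  ring

theorem aParam_eq (n : ℕ) :
    p.aParam n = -(p.expo n : ℂ) + Complex.I * ((p.β / p.expo n : ℝ) : ℂ) := by
  simp only [aParam, expo]; push_cast; ring

theorem eigenPoly_eval (n : ℕ) (z : ℂ) :
    (p.eigenPoly n).eval z
      = jacobiP n (p.aParam n) (starRingEnd ℂ (p.aParam n)) (Complex.I * z) := by
  rw [← jacobiShifted_eval, eigenPoly, eval_comp]
  congr 1
  simp; ring

theorem eigenPoly_ode (n : ℕ) :
    (1 + X ^ 2) * derivative (derivative (p.eigenPoly n))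
      = (2 * p.groundPoly n - 2 * X) * derivative (p.eigenPoly n)
        - C ((n : ℂ) * (n + 2 * p.ν + 1)) * p.eigenPoly n := by
  set a := p.aParam n with ha
  set J := jacobiShifted n a (starRingEnd ℂ a) with hJ
  set T : ℂ[X] := C (Complex.I / 2) * X - C (1 / 2) with hT
  have hT' : derivative T = C (Complex.I / 2) := by simp [hT]
  have hode := congrArg (fun q : ℂ[X] => q.comp T) (jacobiShifted_ode n a (starRingEnd ℂ a))
  simp only [add_comp, mul_comp, X_comp, C_comp, one_comp] at hode
  have e1 : derivative (p.eigenPoly n) = C (Complex.I / 2) * (derivative J).comp T := by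
    rw [eigenPoly, derivative_comp, hT']
  have e2 : derivative (derivative (p.eigenPoly n))
      = C (Complex.I / 2) * C (Complex.I / 2) * (derivative (derivative J)).comp T := by
    rw [e1, derivative_mul, derivative_C, derivative_comp, hT']; ring
  have e0 : p.eigenPoly n = J.comp T := rfl
  rw [e2, e1, e0]
  have ea : (C (a + 1) : ℂ[X])
      = -C (p.expo n : ℂ) + 2 * C (Complex.I / 2) * C ((p.β / p.expo n : ℝ) : ℂ) + 1 := by
    rw [← map_ofNat C 2, ← C_mul, ← C_mul, ← C_neg, ← C_1, ← C_add, ← C_add, ha, aParam_eq]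
    congr 1; ring
  rw [show a + starRingEnd ℂ a + 2 = -2 * (p.expo n : ℂ) + 2 by rw [aParam_add_conj],
    show (n : ℂ) + a + starRingEnd ℂ a + 1 = -((n : ℂ) + 2 * p.ν + 1) by
      rw [add_assoc (n : ℂ), aParam_add_conj, expo]; push_cast; ring, ea] at hode
  have hI : (C (Complex.I / 2) : ℂ[X]) * C (Complex.I / 2) = - C (1 / 4) := by
    rw [← C_mul, ← C_neg]; congr 1
    linear_combination (1 / 4) * Complex.I_sq
  have h2 : (C (1 / 2) : ℂ[X]) * 2 = 1 := by
    rw [← map_ofNat C 2, ← C_mul]; norm_num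
  have h4 : (C (1 / 4) : ℂ[X]) * 4 = 1 := by
    rw [← map_ofNat C 4, ← C_mul]; norm_num
  -- Under the substitution (iX - 1)/2 the leading coefficient T(T+1) of Jacobi's equation becomes
  -- -(1+X²)/4.
  have hTT : 4 * (T * (T + 1)) = -(1 + X ^ 2) := by
    rw [hT]
    linear_combination 4 * X ^ 2 * hI +
      (4 * (C (Complex.I / 2) * X) + 1 - 2 * C (1 / 2)) * (-h2) - X ^ 2 * h4
  rw [groundPoly]
  simp only [C_add, C_mul, C_neg, map_ofNat] at hode ⊢
  have hI' : (C (Complex.I / 2) : ℂ[X]) * X = T + C (1 / 2) := by rw [hT]; ring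
  linear_combination hode + (1 + X ^ 2) * (derivative (derivative J)).comp T * hI
    + (T * (T + 1)) * (derivative (derivative J)).comp T * h4
    - C (1 / 4) * (derivative (derivative J)).comp T * hTT
    - 2 * (C (p.expo n : ℂ) - 1) * (derivative J).comp T * hI'
    - (C (p.expo n : ℂ) - 1) * (derivative J).comp T * h2

/-- The factorization is compared at levels 0 and n: the second-order terms agree, and at level n
`raisePoly` is just -(1+X²) times the derivative, so Jacobi's equation applies. The leftover is
n(n+2ν+1)(1+X²) in both. -/
theorem lowerPoly_raisePoly_eigenPoly (hν : 0 ≤ p.ν) (n : ℕ) :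
    p.lowerPoly n 0 (p.raisePoly n 0 (p.eigenPoly n))
      = C ((p.redEnergy n - p.redEnergy 0 : ℝ) : ℂ) * p.eigenPoly n := by
  have h1 := lowerPoly_raisePoly hν n 0 (p.eigenPoly n)
  have h2 := lowerPoly_raisePoly hν n n (p.eigenPoly n)
  have h3 := p.eigenPoly_ode n
  have h4 : p.lowerPoly n n (p.raisePoly n n (p.eigenPoly n))
      = (1 + X ^ 2) * (C ((n : ℂ) * (n + 2 * p.ν + 1)) * p.eigenPoly n) := by
    simp only [lowerPoly, raisePoly, derivPoly, derivative_sub, derivative_mul, derivative_add,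
      derivative_one, derivative_X_pow, map_natCast]
    push_cast
    linear_combination -(1 + X ^ 2) * h3
  have h5 : (C (p.expo n * (p.expo n - 1) : ℂ) : ℂ[X])
      = C (p.expo 0 * (p.expo 0 - 1) : ℂ) + C ((n : ℂ) * (n + 2 * p.ν + 1)) := by
    rw [← C_add]; congr 1
    simp only [expo]; push_cast; ring
  rw [Complex.ofReal_sub, C_sub]
  linear_combination h1 - h2 + h4 - (1 + X ^ 2) * p.eigenPoly n * h5

theorem raisePoly_C_mul (n k : ℕ) (c : ℂ) (R : ℂ[X]) :
    p.raisePoly n k (C c * R) = C c * p.raisePoly n k R := by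
  simp only [raisePoly, derivPoly, derivative_mul, derivative_C]; ring

/-- Induction on k: apply `raisePoly` to the relation at level k, then exchange the factors by shape
invariance; the gaps telescope. -/
theorem lowerPoly_hierPoly_succ (hν : 0 ≤ p.ν) (n k : ℕ) :
    p.lowerPoly n k (p.hierPoly n (k + 1))
      = C ((p.redEnergy n - p.redEnergy k : ℝ) : ℂ) * p.hierPoly n k := by
  induction k with
  | zero => exact lowerPoly_raisePoly_eigenPoly hν n
  | succ k ih =>
    have h := raisePoly_lowerPoly hν n k (p.hierPoly n (k + 1))
    rw [ih, raisePoly_C_mul] at h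
    have e1 : p.raisePoly n k (p.hierPoly n k) = p.hierPoly n (k + 1) := rfl
    have e2 : p.raisePoly n (k + 1) (p.hierPoly n (k + 1)) = p.hierPoly n (k + 2) := rfl
    rw [e1, e2] at h
    simp only [Complex.ofReal_sub, C_sub] at h ⊢
    linear_combination -h

theorem eigenPoly_natDegree_le (n : ℕ) : (p.eigenPoly n).natDegree ≤ n := by
  rw [eigenPoly]
  refine natDegree_comp_le.trans ?_
  have h1 : (jacobiShifted n (p.aParam n) (starRingEnd ℂ (p.aParam n))).natDegree ≤ n := by
    rw [natDegree_le_iff_coeff_eq_zero]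
    intro k hk
    rw [jacobiShifted_coeff, if_neg (by omega)]
  have h2 : (C (Complex.I / 2) * X - C (1 / 2) : ℂ[X]).natDegree ≤ 1 := by
    rw [sub_eq_add_neg, ← C_neg]; exact natDegree_linear_le
  calc _ ≤ n * 1 := Nat.mul_le_mul h1 h2
    _ = n := mul_one n

theorem raisePoly_coeff_succ (n k j : ℕ) (R : ℂ[X]) :
    (p.raisePoly n k R).coeff (j + 1) = ((n : ℂ) - k - j) * R.coeff j
      - ((p.β / p.expo n : ℝ) - (p.β / p.expo k : ℝ) : ℂ) * R.coeff (j + 1)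
      - (j + 2) * R.coeff (j + 2) := by
  have : p.raisePoly n k R = C ((n : ℂ) - k) * (X * R)
      - C ((p.β / p.expo n : ℝ) - (p.β / p.expo k : ℝ) : ℂ) * R - derivative R
      - X * (X * derivative R) := by
    have e : (C (p.expo n : ℂ) : ℂ[X]) = C ((n : ℂ) - k) + C (p.expo k : ℂ) := by
      rw [← C_add]; congr 1; simp only [expo]; push_cast; ring
    simp only [raisePoly, derivPoly, groundPoly, e, C_sub]
    ring
  rw [this]
  rcases j with _ | j
  · simp only [coeff_sub, coeff_C_mul, coeff_X_mul, coeff_derivative, mul_coeff_zero, coeff_X_zero]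
    push_cast; ring
  · simp only [coeff_sub, coeff_C_mul, coeff_X_mul, coeff_derivative]
    push_cast; ring

theorem lowerPoly_coeff_succ (n k j : ℕ) (R : ℂ[X]) :
    (p.lowerPoly n k R).coeff (j + 1) = ((j : ℂ) - p.expo n - p.expo k) * R.coeff j
      + ((p.β / p.expo n : ℝ) + (p.β / p.expo k : ℝ) : ℂ) * R.coeff (j + 1)
      + (j + 2) * R.coeff (j + 2) := by
  have : p.lowerPoly n k R = C (-(p.expo n : ℂ) - p.expo k) * (X * R)
      + C ((p.β / p.expo n : ℝ) + (p.β / p.expo k : ℝ) : ℂ) * R + derivative R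
      + X * (X * derivative R) := by
    simp only [lowerPoly, derivPoly, groundPoly, C_sub, C_add, C_neg]
    ring
  rw [this]
  rcases j with _ | j
  · simp only [coeff_add, coeff_C_mul, coeff_X_mul, coeff_derivative, mul_coeff_zero, coeff_X_zero]
    push_cast; ring
  · simp only [coeff_add, coeff_C_mul, coeff_X_mul, coeff_derivative]
    push_cast; ring

/-- The degree drops to n-k, and at k = n+1 the polynomial is zero. A step could raise the degree by
one, but the would-be leading coefficient has the factor n-k-j, which vanishes at the top degree j =
n-k. -/
theorem hierPoly_coeff_eq_zero (hν : 0 ≤ p.ν) (n k : ℕ) (hk : k ≤ n + 1) (j : ℕ)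
    (hj : n + 1 ≤ j + k) : (p.hierPoly n k).coeff j = 0 := by
  induction k generalizing j with
  | zero =>
    exact coeff_eq_zero_of_natDegree_lt ((eigenPoly_natDegree_le n).trans_lt (by omega))
  | succ k ih =>
    have ih' := ih (by omega)
    have hhigh : ∀ i, n + 1 ≤ i + k → (p.hierPoly n (k + 1)).coeff i = 0 := by
      intro i hi
      obtain ⟨i, rfl⟩ : ∃ i', i = i' + 1 := ⟨i - 1, by omega⟩
      rw [hierPoly, raisePoly_coeff_succ, ih' (i + 1) (by omega), ih' (i + 2) (by omega)]
      rcases Nat.lt_or_ge (i + k) (n + 1) with h | h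
      · have : (n : ℂ) = i + k := by
          have : n = i + k := by omega
          rw [this]; push_cast; ring
        rw [this]; ring
      · rw [ih' i (by omega)]; ring
    rcases Nat.lt_or_ge (j + k) (n + 1) with h | h
    · have hlow := congrArg (fun q : ℂ[X] => q.coeff (j + 1)) (lowerPoly_hierPoly_succ hν n k)
      simp only [lowerPoly_coeff_succ, coeff_C_mul] at hlow
      rw [hhigh (j + 1) (by omega), hhigh (j + 2) (by omega), ih' (j + 1) (by omega)] at hlow
      have hne : (j : ℂ) - p.expo n - p.expo k ≠ 0 := by
        have h1 : (j : ℝ) - p.expo n - p.expo k ≠ 0 := by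
          have h2 := expo_pos hν k
          have h3 : (j : ℝ) ≤ n := by exact_mod_cast (by omega : j ≤ n)
          unfold expo at *
          linarith
        exact_mod_cast h1
      simpa [hne] using hlow
    · exact hhigh j h

theorem hierPoly_natDegree_le (hν : 0 ≤ p.ν) (n k : ℕ) (hk : k ≤ n + 1) :
    (p.hierPoly n k).natDegree ≤ n := by
  rcases Nat.eq_zero_or_pos k with rfl | h
  · exact eigenPoly_natDegree_le n
  · rw [natDegree_le_iff_coeff_eq_zero]
    intro j hj
    exact hierPoly_coeff_eq_zero hν n k hk j (by omega)

theorem redEnergy_sub (hν : 0 ≤ p.ν) (n k : ℕ) :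
    p.redEnergy n - p.redEnergy k = (p.expo n - p.expo k) * (p.expo n + p.expo k)
      * (1 + p.β ^ 2 / (p.expo k * p.expo n) ^ 2) := by
  have h1 := (expo_pos hν n).ne'
  have h2 := (expo_pos hν k).ne'
  unfold redEnergy
  field_simp
  ring

theorem redEnergy_sub_pos (hν : 0 ≤ p.ν) {n k : ℕ} (h : k < n) :
    0 < p.redEnergy n - p.redEnergy k := by
  rw [redEnergy_sub hν]
  have h1 := expo_pos hν n
  have h2 := expo_pos hν k
  have h3 : 0 < p.expo n - p.expo k := by
    have : (k : ℝ) < n := by exact_mod_cast h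
    unfold expo; linarith
  positivity

theorem ascPochhammer_eval_ne_zero_of_re_neg {n : ℕ} {z : ℂ} (h : z.re + n < 1) :
    (ascPochhammer ℂ n).eval z ≠ 0 := by
  induction n with
  | zero => simp
  | succ n ih =>
    push_cast at h
    rw [ascPochhammer_succ_eval]
    refine mul_ne_zero (ih (by linarith)) fun h0 => ?_
    have := congrArg Complex.re h0
    simp at this
    linarith

theorem aParam_re (n : ℕ) : (p.aParam n).re = -p.expo n := by
  rw [aParam_eq]; simp [Complex.mul_re]

/-- The factors a_n+1+i with i < n have real part -n-ν+i < 0. -/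
theorem ascPochhammer_aParam_ne_zero (hν : 0 ≤ p.ν) {n k : ℕ} (hk : k ≤ n) :
    (ascPochhammer ℂ k).eval (p.aParam n + 1) ≠ 0 := by
  apply ascPochhammer_eval_ne_zero_of_re_neg
  rw [Complex.add_re, aParam_re, Complex.one_re, expo]
  have : (k : ℝ) ≤ n := by exact_mod_cast hk
  linarith

/-- If level k+1 vanished, lowering it would make a nonzero gap times level k vanish. -/
theorem hierPoly_ne_zero (hν : 0 ≤ p.ν) (n k : ℕ) (hk : k ≤ n) : p.hierPoly n k ≠ 0 := by
  induction k with
  | zero =>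
    intro h0
    -- At -i the Jacobi argument is 1, where only the constant term (a_n+1)_n/n! survives.
    have h := congrArg (eval (-Complex.I)) h0
    rw [hierPoly, eigenPoly_eval, ← jacobiShifted_eval] at h
    have e : (Complex.I * -Complex.I - 1) / 2 = 0 := by
      linear_combination (-1 / 2) * Complex.I_sq
    rw [e, ← coeff_zero_eq_eval_zero, jacobiShifted_coeff, if_pos (Nat.zero_le n)] at h
    have h1 := ascPochhammer_aParam_ne_zero hν (le_refl n)
    have h2 : ((n.factorial : ℕ) : ℂ) ≠ 0 := Nat.cast_ne_zero.2 n.factorial_ne_zero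
    simp [h1, h2] at h
  | succ k ih =>
    intro h0
    have h := lowerPoly_hierPoly_succ hν n k
    have hl : p.lowerPoly n k 0 = 0 := by simp [lowerPoly, derivPoly]
    rw [h0, hl] at h
    have hc : ((p.redEnergy n - p.redEnergy k : ℝ) : ℂ) ≠ 0 := by
      exact_mod_cast (redEnergy_sub_pos hν (by omega : k < n)).ne'
    exact mul_ne_zero (C_ne_zero.2 hc) (ih (by omega)) h.symm

theorem hierPoly_self (hν : 0 ≤ p.ν) (n : ℕ) : ∃ c : ℂ, c ≠ 0 ∧ p.hierPoly n n = C c := by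
  have h : p.hierPoly n n = C ((p.hierPoly n n).coeff 0) := by
    apply eq_C_of_natDegree_le_zero
    rw [natDegree_le_iff_coeff_eq_zero]
    intro j hj
    exact hierPoly_coeff_eq_zero hν n n (by omega) j (by omega)
  exact ⟨_, fun h0 => hierPoly_ne_zero hν n n le_rfl (by rw [h, h0, C_0]), h⟩

end PoschlTeller

/-! ### Waves on (0, L): derivatives, smoothness and behaviour at the endpoints -/

namespace PoschlTeller

open Polynomial

variable {p : PoschlTeller}

variable (p) in
/-- The function `sin^{n+ν+1}(πx/L) exp(-βπx/(L(n+ν+1))) R(cot(πx/L))`. -/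
def polyWave (n : ℕ) (R : ℂ[X]) (x : ℝ) : ℂ :=
  ((Real.sin (Real.pi * x / p.L) ^ p.expo n : ℝ) : ℂ)
    * (Real.exp (-(p.β / p.expo n * (Real.pi * x / p.L))) : ℝ)
    * R.eval ((Real.cot (Real.pi * x / p.L) : ℝ) : ℂ)

theorem sin_pos_of_mem (hL : 0 < p.L) {x : ℝ} (hx : x ∈ Ioo 0 p.L) :
    0 < Real.sin (Real.pi * x / p.L) := by
  have := Real.pi_pos
  apply Real.sin_pos_of_pos_of_lt_pi
  · have := hx.1; positivity
  · rw [div_lt_iff₀ hL]; exact mul_lt_mul_of_pos_left hx.2 this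

theorem hasDerivAt_cot {θ : ℝ} (h : Real.sin θ ≠ 0) :
    HasDerivAt Real.cot (-(1 + Real.cot θ ^ 2)) θ := by
  have h1 := (Real.hasDerivAt_cos θ).div (Real.hasDerivAt_sin θ) h
  have h2 : Real.cot = fun y => Real.cos y / Real.sin y :=
    funext fun y => Real.cot_eq_cos_div_sin y
  rw [h2]
  convert! h1 using 1
  field_simp
  ring

theorem hasDerivAt_polyWave (hL : 0 < p.L) (n : ℕ) (R : ℂ[X]) {x : ℝ} (hx : x ∈ Ioo 0 p.L) :
    HasDerivAt (p.polyWave n R) ((Real.pi / p.L : ℝ) * p.polyWave n (p.derivPoly n R) x) x := by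
  have hsin := sin_pos_of_mem hL hx
  have hθ : HasDerivAt (fun y : ℝ => Real.pi * y / p.L) (Real.pi / p.L) x := by
    simpa using ((hasDerivAt_id x).const_mul Real.pi).div_const p.L
  have h1 := ((hθ.sin).rpow_const (p := p.expo n) (Or.inl hsin.ne')).ofReal_comp
  have h2 := ((hθ.const_mul (p.β / p.expo n)).neg.exp).ofReal_comp
  have h3 := (R.hasDerivAt ((Real.cot (Real.pi * x / p.L) : ℝ) : ℂ)).comp x
    (((hasDerivAt_cot hsin.ne').comp x hθ).ofReal_comp)
  have h := (h1.mul h2).mul h3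
  refine h.congr_deriv ?_
  have hs : Real.sin (Real.pi * x / p.L) ^ p.expo n
      = Real.sin (Real.pi * x / p.L) ^ (p.expo n - 1) * Real.sin (Real.pi * x / p.L) := by
    rw [← Real.rpow_add_one hsin.ne', sub_add_cancel]
  have hc : Real.cos (Real.pi * x / p.L)
      = Real.cot (Real.pi * x / p.L) * Real.sin (Real.pi * x / p.L) := by
    rw [Real.cot_eq_cos_div_sin]; field_simp
  simp only [polyWave, derivPoly, groundPoly, Pi.mul_apply, Pi.neg_apply, hs, hc, eval_sub, eval_mul, eval_add,
    eval_C, eval_X, eval_one, eval_pow, Function.comp_apply]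
  push_cast
  ring

theorem deriv_polyWave (hL : 0 < p.L) (n : ℕ) (R : ℂ[X]) {x : ℝ} (hx : x ∈ Ioo 0 p.L) :
    deriv (p.polyWave n R) x = (Real.pi / p.L : ℝ) * p.polyWave n (p.derivPoly n R) x :=
  (hasDerivAt_polyWave hL n R hx).deriv

theorem contDiffOn_polyWave (hL : 0 < p.L) (n : ℕ) (R : ℂ[X]) :
    ContDiffOn ℝ ∞ (p.polyWave n R) (Ioo 0 p.L) := by
  rw [contDiffOn_infty]
  intro k
  induction k generalizing R with
  | zero =>
    exact contDiffOn_zero.2 fun x hx =>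
      (hasDerivAt_polyWave hL n R hx).continuousAt.continuousWithinAt
  | succ k ih =>
    push_cast
    rw [contDiffOn_succ_iff_deriv_of_isOpen isOpen_Ioo]
    refine ⟨fun x hx => (hasDerivAt_polyWave hL n R hx).differentiableAt.differentiableWithinAt,
      by simp, ?_⟩
    exact (contDiffOn_const.mul (ih (p.derivPoly n R))).congr fun x hx => deriv_polyWave hL n R hx

theorem polyWave_C_mul (n : ℕ) (c : ℂ) (R : ℂ[X]) (x : ℝ) :
    p.polyWave n (C c * R) x = c * p.polyWave n R x := by
  simp only [polyWave, eval_mul, eval_C]; ring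

variable (p) in
/-- `f` agrees on `(0, L)` with the product of `sin(πx/L)` and a continuous function on `ℝ`. -/
def VanishesAtEnds (f : ℝ → ℂ) : Prop :=
  ∃ g : ℝ → ℂ, Continuous g ∧
    ∀ x ∈ Ioo 0 p.L, f x = (Real.sin (Real.pi * x / p.L) : ℂ) * g x

theorem VanishesAtEnds.const_mul {f : ℝ → ℂ} (hf : p.VanishesAtEnds f) (c : ℂ) :
    p.VanishesAtEnds fun x => c * f x := by
  obtain ⟨g, hg, h⟩ := hf
  exact ⟨fun x => c * g x, continuous_const.mul hg, fun x hx => by simp only [h x hx]; ring⟩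

theorem VanishesAtEnds.congr {f f' : ℝ → ℂ} (hf : p.VanishesAtEnds f)
    (h : EqOn f' f (Ioo 0 p.L)) : p.VanishesAtEnds f' := by
  obtain ⟨g, hg, h'⟩ := hf
  exact ⟨g, hg, fun x hx => by rw [h hx, h' x hx]⟩

/-- Since cot^j = cos^j / sin^j with j ≤ n, the power sin^{n+ν+1} pays for the poles and still
leaves one full factor sin times sin^{n+ν-j}, whose exponent is nonnegative. -/
theorem vanishesAtEnds_polyWave (hL : 0 < p.L) (hν : 0 ≤ p.ν) {n : ℕ} {R : ℂ[X]}
    (hR : R.natDegree ≤ n) : p.VanishesAtEnds (p.polyWave n R) := by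
  refine ⟨fun x => ∑ j ∈ Finset.range (n + 1), R.coeff j *
    (((Real.sin (Real.pi * x / p.L) ^ (p.expo n - 1 - j) : ℝ) : ℂ)
      * (Real.cos (Real.pi * x / p.L) : ℂ) ^ j
      * (Real.exp (-(p.β / p.expo n * (Real.pi * x / p.L))) : ℝ)), ?_, ?_⟩
  · refine continuous_finsetSum _ fun j hj => ?_
    have hj' : (j : ℝ) ≤ n := by exact_mod_cast Nat.lt_succ_iff.1 (Finset.mem_range.1 hj)
    have : Continuous fun x : ℝ => Real.sin (Real.pi * x / p.L) ^ (p.expo n - 1 - j) := by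
      refine Continuous.rpow_const (by fun_prop) fun x => Or.inr ?_
      unfold expo; linarith
    fun_prop
  · intro x hx
    have hsin := sin_pos_of_mem hL hx
    rw [polyWave, eval_eq_sum_range' (Nat.lt_succ_of_le hR), Finset.mul_sum, Finset.mul_sum]
    refine Finset.sum_congr rfl fun j _ => ?_
    have hs : Real.sin (Real.pi * x / p.L) ^ p.expo n
        = Real.sin (Real.pi * x / p.L) ^ (p.expo n - 1 - j) * Real.sin (Real.pi * x / p.L) ^ j
          * Real.sin (Real.pi * x / p.L) := by
      rw [← Real.rpow_natCast, ← Real.rpow_add hsin, ← Real.rpow_add_one hsin.ne']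
      congr 1; ring
    have hc : Real.cos (Real.pi * x / p.L)
        = Real.cot (Real.pi * x / p.L) * Real.sin (Real.pi * x / p.L) := by
      rw [Real.cot_eq_cos_div_sin]; field_simp
    rw [hs, hc]
    push_cast
    ring

theorem VanishesAtEnds.memL2 {f : ℝ → ℂ} (hf : p.VanishesAtEnds f) : p.MemL2 f := by
  obtain ⟨g, hg, h⟩ := hf
  have hc : Continuous fun x : ℝ => (Real.sin (Real.pi * x / p.L) : ℂ) * g x := by fun_prop
  have h2 : MemLp (fun x : ℝ => (Real.sin (Real.pi * x / p.L) : ℂ) * g x) 2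
      (volume.restrict (Ioo 0 p.L)) := by
    obtain ⟨K, hK⟩ := (isCompact_Icc (a := (0 : ℝ)) (b := p.L)).exists_bound_of_continuousOn
      hc.continuousOn
    refine MemLp.of_bound hc.aestronglyMeasurable K ?_
    exact (ae_restrict_iff' measurableSet_Ioo).2
      (Eventually.of_forall fun x hx => hK x (Ioo_subset_Icc_self hx))
  refine (memLp_congr_ae ?_).2 h2
  exact (ae_restrict_iff' measurableSet_Ioo).2 (Eventually.of_forall h)

theorem VanishesAtEnds.tendsto_left {f : ℝ → ℂ} (hL : 0 < p.L) (hf : p.VanishesAtEnds f) :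
    Tendsto f (𝓝[>] 0) (𝓝 0) := by
  obtain ⟨g, hg, h⟩ := hf
  have hc : Continuous fun x : ℝ => (Real.sin (Real.pi * x / p.L) : ℂ) * g x := by fun_prop
  have ht := (hc.tendsto 0).mono_left (nhdsWithin_le_nhds (s := Ioi 0))
  simp only [mul_zero, zero_div, Real.sin_zero, Complex.ofReal_zero, zero_mul] at ht
  refine ht.congr' ?_
  filter_upwards [Ioo_mem_nhdsGT hL] with x hx using (h x hx).symm

theorem VanishesAtEnds.tendsto_right {f : ℝ → ℂ} (hL : 0 < p.L) (hf : p.VanishesAtEnds f) :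
    Tendsto f (𝓝[<] p.L) (𝓝 0) := by
  obtain ⟨g, hg, h⟩ := hf
  have hc : Continuous fun x : ℝ => (Real.sin (Real.pi * x / p.L) : ℂ) * g x := by fun_prop
  have ht := (hc.tendsto p.L).mono_left (nhdsWithin_le_nhds (s := Iio p.L))
  rw [mul_div_cancel_right₀ _ hL.ne'] at ht
  simp only [Real.sin_pi, Complex.ofReal_zero, zero_mul] at ht
  refine ht.congr' ?_
  filter_upwards [Ioo_mem_nhdsLT hL] with x hx using (h x hx).symm

theorem locAC_of_contDiffOn {f : ℝ → ℂ} (hf : ContDiffOn ℝ 1 f (Ioo 0 p.L)) : p.LocAC f := by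
  intro a b ha hab hb
  apply ContDiffOn.absolutelyContinuousOnInterval
  refine hf.mono ?_
  rw [uIcc_of_le hab.le]
  exact fun x hx => ⟨ha.trans_le hx.1, hx.2.trans_lt hb⟩

end PoschlTeller

/-! ### Complex absolutely continuous functions, and a criterion for zero boundary values -/

theorem LipschitzWith.comp_absolutelyContinuousOnInterval {X Y : Type*} [PseudoMetricSpace X]
    [PseudoMetricSpace Y] {K : NNReal} {φ : X → Y} (hφ : LipschitzWith K φ) {f : ℝ → X} {a b : ℝ}
    (hf : AbsolutelyContinuousOnInterval f a b) :
    AbsolutelyContinuousOnInterval (fun x => φ (f x)) a b := by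
  refine squeeze_zero (fun _ => Finset.sum_nonneg fun _ _ => dist_nonneg) (fun E => ?_)
    (by simpa using Tendsto.const_mul (K : ℝ) hf)
  rw [Finset.mul_sum]
  exact Finset.sum_le_sum fun i _ => hφ.dist_le_mul _ _

theorem AbsolutelyContinuousOnInterval.re {f : ℝ → ℂ} {a b : ℝ}
    (hf : AbsolutelyContinuousOnInterval f a b) :
    AbsolutelyContinuousOnInterval (fun x => (f x).re) a b :=
  (Complex.reCLM.lipschitz).comp_absolutelyContinuousOnInterval hf

theorem AbsolutelyContinuousOnInterval.im {f : ℝ → ℂ} {a b : ℝ}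
    (hf : AbsolutelyContinuousOnInterval f a b) :
    AbsolutelyContinuousOnInterval (fun x => (f x).im) a b :=
  (Complex.imCLM.lipschitz).comp_absolutelyContinuousOnInterval hf

theorem AbsolutelyContinuousOnInterval.conj {f : ℝ → ℂ} {a b : ℝ}
    (hf : AbsolutelyContinuousOnInterval f a b) :
    AbsolutelyContinuousOnInterval (fun x => starRingEnd ℂ (f x)) a b :=
  (Complex.isometry_conj.lipschitz).comp_absolutelyContinuousOnInterval hf

theorem AbsolutelyContinuousOnInterval.ae_hasDerivAt_complex {f : ℝ → ℂ} {a b : ℝ}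
    (hf : AbsolutelyContinuousOnInterval f a b) :
    ∀ᵐ x : ℝ, x ∈ uIcc a b → HasDerivAt f
      (((deriv (fun y => (f y).re) x : ℝ) : ℂ)
        + ((deriv (fun y => (f y).im) x : ℝ) : ℂ) * Complex.I) x := by
  filter_upwards [hf.re.ae_differentiableAt, hf.im.ae_differentiableAt] with x h1 h2 hx
  have h := ((h1 hx).hasDerivAt.ofReal_comp).add
    ((h2 hx).hasDerivAt.ofReal_comp.mul_const Complex.I)
  refine h.congr_of_eventuallyEq (Eventually.of_forall fun y => ?_)
  simp [Complex.re_add_im]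

/-- Reduction to the real fundamental theorem of calculus for the real and imaginary parts, which
are absolutely continuous as Lipschitz images. -/
theorem AbsolutelyContinuousOnInterval.integral_deriv_eq_sub_complex {f : ℝ → ℂ} {a b : ℝ}
    (hf : AbsolutelyContinuousOnInterval f a b) :
    ∫ x in a..b, deriv f x = f b - f a := by
  have h1 : ∫ x in a..b, deriv f x = ∫ x in a..b,
      (((deriv (fun y => (f y).re) x : ℝ) : ℂ)
        + ((deriv (fun y => (f y).im) x : ℝ) : ℂ) * Complex.I) := by
    apply intervalIntegral.integral_congr_ae
    filter_upwards [hf.ae_hasDerivAt_complex] with x hx hx'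
    exact (hx (uIoc_subset_uIcc hx')).deriv
  have hre : IntervalIntegrable (fun x => ((deriv (fun y => (f y).re) x : ℝ) : ℂ)) volume a b :=
    ⟨hf.re.intervalIntegrable_deriv.1.ofReal, hf.re.intervalIntegrable_deriv.2.ofReal⟩
  have him : IntervalIntegrable (fun x => ((deriv (fun y => (f y).im) x : ℝ) : ℂ)) volume a b :=
    ⟨hf.im.intervalIntegrable_deriv.1.ofReal, hf.im.intervalIntegrable_deriv.2.ofReal⟩
  rw [h1, intervalIntegral.integral_add hre (him.mul_const _), intervalIntegral.integral_mul_const,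
    intervalIntegral.integral_ofReal, intervalIntegral.integral_ofReal,
    hf.re.integral_deriv_eq_sub, hf.im.integral_deriv_eq_sub]
  apply Complex.ext <;> simp

/-- A nonzero limit makes the quotient at least a constant times 1/x near 0, because sin θ ≤ θ, and
1/x is not integrable there. -/
theorem eq_zero_of_tendsto_of_integrableOn_div_sin {v : ℝ → ℂ} {K : ℂ} {L : ℝ} (hL : 0 < L)
    (hv : Tendsto v (𝓝[>] 0) (𝓝 K))
    (hi : IntegrableOn (fun x => v x / (Real.sin (Real.pi * x / L) : ℂ)) (Ioo 0 L)) : K = 0 := by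
  by_contra hK
  have hK' : 0 < ‖K‖ := norm_pos_iff.2 hK
  have hev : ∀ᶠ x in 𝓝[>] (0 : ℝ), ‖K‖ / 2 < ‖v x‖ := hv.norm.eventually_const_lt (by linarith)
  obtain ⟨r, hr, hrv⟩ := mem_nhdsGT_iff_exists_Ioo_subset.1 hev
  have hr0 : (0 : ℝ) < r := hr
  set d := min r L with hd
  have hd0 : 0 < d := lt_min hr0 hL
  have hint : IntegrableOn (fun x : ℝ => x⁻¹) (Ioo 0 d) := by
    refine Integrable.mono' (((hi.mono_set (Ioo_subset_Ioo_right (min_le_right r L))).norm).const_mul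
      (Real.pi / L * (2 / ‖K‖))) (by fun_prop) ?_
    refine (ae_restrict_iff' measurableSet_Ioo).2 (Eventually.of_forall fun x hx => ?_)
    have hx0 := hx.1
    have hxv : ‖K‖ / 2 < ‖v x‖ := hrv ⟨hx.1, hx.2.trans_le (min_le_left _ _)⟩
    have hpi := Real.pi_pos
    have hxL : x < L := hx.2.trans_le (min_le_right _ _)
    have hθ : 0 < Real.pi * x / L := by positivity
    have hsin : 0 < Real.sin (Real.pi * x / L) := by
      apply Real.sin_pos_of_pos_of_lt_pi hθ
      rw [div_lt_iff₀ hL]; exact mul_lt_mul_of_pos_left hxL hpi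
    have hle := Real.sin_le hθ.le
    rw [Real.norm_of_nonneg (by positivity), norm_div, Complex.norm_real,
      Real.norm_of_nonneg hsin.le]
    calc x⁻¹ = Real.pi / L * 1 / (Real.pi * x / L) := by field_simp
      _ ≤ Real.pi / L * 1 / Real.sin (Real.pi * x / L) := by gcongr
      _ ≤ Real.pi / L * (2 / ‖K‖ * ‖v x‖) / Real.sin (Real.pi * x / L) := by
          gcongr
          rw [div_mul_eq_mul_div, le_div_iff₀ hK']; linarith
      _ = _ := by ring
  rw [← intervalIntegrable_iff_integrableOn_Ioo_of_le hd0.le, intervalIntegrable_inv_iff] at hint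
  rcases hint with h | h
  · exact hd0.ne h
  · exact h left_mem_uIcc

/-! ### Membership in the domain of the adjoint -/

namespace PoschlTeller

variable {p : PoschlTeller}

/-- Integration by parts against an arbitrary ψ in the maximal domain. Nothing is known about ψ at
the endpoints beyond square integrability, so the decay of f has to remove the boundary terms. -/
theorem memDomAdag_of_vanishesAtEnds (hL : 0 < p.L) {k : ℕ} {f : ℝ → ℂ}
    (hW : ∀ x ∈ Ioo 0 p.L, starRingEnd ℂ (p.superpot k x) = p.superpot k x)
    (hf : ContDiffOn ℝ 1 f (Ioo 0 p.L)) (hf0 : p.VanishesAtEnds f)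
    (hA : p.MemL2 (p.opAdag k f)) : p.MemDomAdag k f := by
  refine ⟨hf0.memL2, locAC_of_contDiffOn hf, hA, fun ψ hψ => ?_⟩
  obtain ⟨hψ2, hψac, hψA⟩ := hψ
  set u : ℝ → ℂ := fun x => starRingEnd ℂ (ψ x) * f x with hu
  set h : ℝ → ℂ := fun x => starRingEnd ℂ (p.opA k ψ x) * f x
    - starRingEnd ℂ (ψ x) * p.opAdag k f x with hh
  have hi1 : IntegrableOn (fun x => starRingEnd ℂ (p.opA k ψ x) * f x) (Ioo 0 p.L) :=
    hψA.star.integrable_mul hf0.memL2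
  have hi2 : IntegrableOn (fun x => starRingEnd ℂ (ψ x) * p.opAdag k f x) (Ioo 0 p.L) :=
    hψ2.star.integrable_mul hA
  have hi : IntegrableOn h (Ioo 0 p.L) := hi1.sub hi2
  have hii : IntervalIntegrable h volume 0 p.L :=
    (intervalIntegrable_iff_integrableOn_Ioo_of_le hL.le).2 hi
  have huac : ∀ a b : ℝ, 0 < a → a < b → b < p.L → AbsolutelyContinuousOnInterval u a b := by
    intro a b ha hab hb
    exact (hψac a b ha hab hb).conj.smul (locAC_of_contDiffOn hf a b ha hab hb)
  -- For real W the potential terms cancel in `h`, leaving exactly ħ u'.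
  have hderiv : ∀ a b : ℝ, 0 < a → a < b → b < p.L →
      (p.ħ : ℂ) * (u b - u a) = ∫ x in a..b, h x := by
    intro a b ha hab hb
    rw [← (huac a b ha hab hb).integral_deriv_eq_sub_complex,
      ← intervalIntegral.integral_const_mul]
    apply intervalIntegral.integral_congr_ae
    filter_upwards [(hψac a b ha hab hb).ae_hasDerivAt_complex] with x hx hx'
    have hxu := uIoc_subset_uIcc hx'
    have h1 := (hx hxu).differentiableAt.hasDerivAt
    have hxm : x ∈ Ioo 0 p.L := by
      rw [uIcc_of_le hab.le] at hxu
      exact ⟨ha.trans_le hxu.1, hxu.2.trans_lt hb⟩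
    have h2 := ((hf.differentiableOn one_ne_zero x hxm).differentiableAt
      (isOpen_Ioo.mem_nhds hxm)).hasDerivAt
    have h3 : HasDerivAt (fun y => starRingEnd ℂ (ψ y)) (starRingEnd ℂ (deriv ψ x)) x :=
      h1.star
    have h4 := (h3.mul h2).deriv
    change deriv u x = _ at h4
    rw [h4, hh]
    simp only [opA, opAdag, map_add, map_mul, Complex.conj_ofReal, hW x hxm]
    ring
  set F : ℝ → ℂ := fun x => ∫ t in (0 : ℝ)..x, h t with hF
  have hFc : ContinuousOn F (Icc 0 p.L) := by
    have := intervalIntegral.continuousOn_primitive_interval' hii left_mem_uIcc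
    rwa [uIcc_of_le hL.le] at this
  have hFi : ∀ a b, 0 < a → a < b → b < p.L → F b - F a = ∫ x in a..b, h x := by
    intro a b ha hab hb
    apply intervalIntegral.integral_interval_sub_left
    · exact hii.mono_set (by
        rw [uIcc_of_le hL.le, uIcc_of_le (ha.trans hab).le]; exact Icc_subset_Icc_right hb.le)
    · exact hii.mono_set (by
        rw [uIcc_of_le hL.le, uIcc_of_le ha.le]; exact Icc_subset_Icc_right (hab.trans hb).le)
  -- On (0, L), ħu differs by a constant from the primitive of an integrable function, so it has
  -- limits at both ends: K on the left and K + F(L) on the right.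
  obtain ⟨K, hK⟩ : ∃ K : ℂ, ∀ x ∈ Ioo 0 p.L, (p.ħ : ℂ) * u x = K + F x := by
    have hmid : p.L / 2 ∈ Ioo 0 p.L := ⟨by linarith, by linarith⟩
    refine ⟨(p.ħ : ℂ) * u (p.L / 2) - F (p.L / 2), fun x hx => ?_⟩
    rcases lt_trichotomy x (p.L / 2) with hlt | heq | hgt
    · have e1 := hderiv x _ hx.1 hlt hmid.2
      have e2 := hFi x _ hx.1 hlt hmid.2
      linear_combination e2 - e1
    · rw [heq]; ring
    · have e1 := hderiv _ x hmid.1 hgt hx.2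
      have e2 := hFi _ x hmid.1 hgt hx.2
      linear_combination e1 - e2
  have hleft : Tendsto (fun x => (p.ħ : ℂ) * u x) (𝓝[>] 0) (𝓝 K) := by
    have h1 : Tendsto F (𝓝[Icc 0 p.L] 0) (𝓝 (F 0)) := hFc 0 ⟨le_rfl, hL.le⟩
    have h2 : Tendsto F (𝓝[>] 0) (𝓝 (F 0)) := by
      rw [← nhdsWithin_Ioo_eq_nhdsGT hL]
      exact h1.mono_left (nhdsWithin_mono _ Ioo_subset_Icc_self)
    have h3 := h2.const_add K
    have h4 : F 0 = 0 := intervalIntegral.integral_same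
    rw [h4, add_zero] at h3
    refine h3.congr' ?_
    filter_upwards [Ioo_mem_nhdsGT hL] with x hx using (hK x hx).symm
  have hright : Tendsto (fun x => (p.ħ : ℂ) * u x) (𝓝[<] p.L) (𝓝 (K + F p.L)) := by
    have h1 : Tendsto F (𝓝[Icc 0 p.L] p.L) (𝓝 (F p.L)) := hFc p.L ⟨hL.le, le_rfl⟩
    have h2 : Tendsto F (𝓝[<] p.L) (𝓝 (F p.L)) := by
      rw [← nhdsWithin_Ioo_eq_nhdsLT hL]
      exact h1.mono_left (nhdsWithin_mono _ Ioo_subset_Icc_self)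
    refine (h2.const_add K).congr' ?_
    filter_upwards [Ioo_mem_nhdsLT hL] with x hx using (hK x hx).symm
  -- Dividing f by sin leaves the bounded factor `g`, so u/sin is a product of two square integrable
  -- functions.
  have hsinint : IntegrableOn
      (fun x => (p.ħ : ℂ) * u x / (Real.sin (Real.pi * x / p.L) : ℂ)) (Ioo 0 p.L) := by
    obtain ⟨g, hg, hfg⟩ := hf0
    have hg2 : MemLp g 2 (volume.restrict (Ioo 0 p.L)) := by
      obtain ⟨B, hB⟩ := (isCompact_Icc (a := (0 : ℝ)) (b := p.L)).exists_bound_of_continuousOn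
        hg.continuousOn
      exact MemLp.of_bound hg.aestronglyMeasurable B
        ((ae_restrict_iff' measurableSet_Ioo).2
          (Eventually.of_forall fun x hx => hB x (Ioo_subset_Icc_self hx)))
    have hprod : IntegrableOn (fun x => starRingEnd ℂ (ψ x) * g x) (Ioo 0 p.L) :=
      hψ2.star.integrable_mul hg2
    refine Integrable.congr (hprod.const_mul (p.ħ : ℂ)) ?_
    refine (ae_restrict_iff' measurableSet_Ioo).2 (Eventually.of_forall fun x hx => ?_)
    have hs : (Real.sin (Real.pi * x / p.L) : ℂ) ≠ 0 := by
      exact_mod_cast (sin_pos_of_mem hL hx).ne'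
    simp only [hu, hfg x hx]
    field_simp
  have hK0 : K = 0 := eq_zero_of_tendsto_of_integrableOn_div_sin hL hleft hsinint
  have hKL : K + F p.L = 0 := by
    -- The reflection x ↦ L - x carries the right endpoint to 0 and preserves sin(πx/L).
    refine eq_zero_of_tendsto_of_integrableOn_div_sin
      (v := fun x => (p.ħ : ℂ) * u (p.L - x)) hL ?_ ?_
    · refine hright.comp (tendsto_nhdsWithin_iff.2 ⟨?_, ?_⟩)
      · have : Tendsto (fun x : ℝ => p.L - x) (𝓝 0) (𝓝 (p.L - 0)) := by
          exact (continuous_const.sub continuous_id).tendsto 0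
        rw [sub_zero] at this
        exact this.mono_left nhdsWithin_le_nhds
      · filter_upwards [self_mem_nhdsWithin] with x hx
        have : (0 : ℝ) < x := hx
        simp [this]
    · rw [← intervalIntegrable_iff_integrableOn_Ioo_of_le hL.le] at hsinint ⊢
      have := (hsinint.comp_sub_left p.L).symm
      rw [sub_zero, sub_self] at this
      refine this.congr fun x _ => ?_
      rw [show Real.pi * (p.L - x) / p.L = Real.pi - Real.pi * x / p.L by field_simp,
        Real.sin_pi_sub]
  rw [hK0, zero_add] at hKL
  refine ⟨⟨0, ?_, ?_⟩, ?_⟩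
  · rw [hK0] at hleft
    simpa only [hu, mul_assoc] using hleft
  · rw [hK0, hKL, add_zero] at hright
    simpa only [hu, mul_assoc] using hright
  · rw [innerL2, innerL2, ← sub_eq_zero, ← integral_sub hi1 hi2, ← hKL]
    change _ = ∫ t in (0 : ℝ)..p.L, h t
    rw [intervalIntegral.integral_of_le hL.le, integral_Ioc_eq_integral_Ioo]

end PoschlTeller

/-! ### Normalization of φ_n and positivity of O(n) -/

theorem ascPochhammer_eval_neg_natCast {n s : ℕ} (h : s ≤ n) :
    (ascPochhammer ℂ s).eval (-(n : ℂ)) * ((n - s).factorial : ℂ)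
      = (-1) ^ s * (n.factorial : ℂ) := by
  induction s with
  | zero => simp
  | succ s ih =>
    have ih' := ih (by omega)
    obtain ⟨d, rfl⟩ : ∃ d, n = s + 1 + d := ⟨n - (s + 1), by omega⟩
    rw [show s + 1 + d - s = d + 1 by omega, Nat.factorial_succ] at ih'
    rw [show s + 1 + d - (s + 1) = d by omega, ascPochhammer_succ_eval]
    push_cast at ih' ⊢
    linear_combination -ih'

theorem ascPochhammer_eval_add (n m : ℕ) (z : ℂ) :
    (ascPochhammer ℂ (n + m)).eval z
      = (ascPochhammer ℂ n).eval z * (ascPochhammer ℂ m).eval (z + n) := by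
  rw [← ascPochhammer_mul]; simp

theorem ascPochhammer_eval_conj (n : ℕ) (z : ℂ) :
    (ascPochhammer ℂ n).eval (starRingEnd ℂ z) = starRingEnd ℂ ((ascPochhammer ℂ n).eval z) := by
  induction n with
  | zero => simp
  | succ n ih => simp [ascPochhammer_succ_eval, ih]

theorem I_mul_cot_sub_one {θ : ℝ} (h : Real.sin θ ≠ 0) :
    (Complex.I * (Real.cot θ : ℝ) - 1) / 2
      = Complex.I * Complex.exp (Complex.I * θ) / (2 * (Real.sin θ : ℂ)) := by
  have h' : (Real.sin θ : ℂ) ≠ 0 := by exact_mod_cast h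
  rw [Real.cot_eq_cos_div_sin, mul_comm Complex.I (θ : ℂ), Complex.exp_mul_I,
    ← Complex.ofReal_cos, ← Complex.ofReal_sin]
  push_cast at h' ⊢
  field_simp
  linear_combination -Complex.sin (θ : ℂ) * Complex.I_sq

namespace PoschlTeller

variable {p : PoschlTeller}

variable (p) in
/-- The coefficients of the hypergeometric polynomial in the numerator of `φ_n`. -/
def hyperCoeff (n s : ℕ) : ℂ :=
  (ascPochhammer ℂ s).eval (-(n : ℂ)) * (ascPochhammer ℂ s).eval (-2 * (p.ν : ℂ) - n - 1)
    / ((ascPochhammer ℂ s).eval (p.aParam n + 1) * (s.factorial : ℂ))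

/-- Splitting (a+1)_n = (a+1)_s (a+s+1)_{n-s} moves the dependence on s into a denominator, and
(-n)_s supplies n!/(n-s)! up to sign. -/
theorem jacobiShifted_coeff_eq_hyperCoeff (hν : 0 ≤ p.ν) {n s : ℕ} (hs : s ≤ n) :
    (jacobiShifted n (p.aParam n) (starRingEnd ℂ (p.aParam n))).coeff s
      = (ascPochhammer ℂ n).eval (p.aParam n + 1) / (n.factorial : ℂ)
        * ((-1) ^ s * p.hyperCoeff n s) := by
  rw [jacobiShifted_coeff, if_pos hs, hyperCoeff]
  have h1 : (n : ℂ) + p.aParam n + starRingEnd ℂ (p.aParam n) + 1 = -2 * (p.ν : ℂ) - n - 1 := by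
    rw [add_assoc (n : ℂ), aParam_add_conj, expo]; push_cast; ring
  have h2 : (ascPochhammer ℂ n).eval (p.aParam n + 1) = (ascPochhammer ℂ s).eval (p.aParam n + 1)
      * (ascPochhammer ℂ (n - s)).eval (p.aParam n + s + 1) := by
    have h := ascPochhammer_eval_add s (n - s) (p.aParam n + 1)
    rw [Nat.add_sub_cancel' hs] at h
    rw [h, add_right_comm]
  have h3 := ascPochhammer_eval_neg_natCast hs
  have h4 := ascPochhammer_aParam_ne_zero hν hs
  have h5 : ((n - s).factorial : ℂ) ≠ 0 := Nat.cast_ne_zero.2 (Nat.factorial_ne_zero _)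
  have h6 : (s.factorial : ℂ) ≠ 0 := Nat.cast_ne_zero.2 (Nat.factorial_ne_zero _)
  have h7 : (n.factorial : ℂ) ≠ 0 := Nat.cast_ne_zero.2 (Nat.factorial_ne_zero _)
  have h8 : ((-1 : ℂ) ^ s) * (-1) ^ s = 1 := by rw [← mul_pow]; norm_num
  rw [h1, h2]
  have h9 : (ascPochhammer ℂ s).eval (-(n : ℂ)) = (-1) ^ s * (n.factorial : ℂ)
      / ((n - s).factorial : ℂ) := by rw [eq_div_iff h5, h3]
  rw [h9]
  generalize (ascPochhammer ℂ s).eval (-2 * (p.ν : ℂ) - n - 1) = G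
  generalize (ascPochhammer ℂ (n - s)).eval (p.aParam n + s + 1) = G'
  field_simp
  linear_combination (-G * G') * h8

theorem calT_eq (n : ℕ) : p.calT n
    = (n.factorial : ℝ) * ‖(ascPochhammer ℂ n).eval (p.aParam n + 1)‖⁻¹ := by
  have : -(n : ℂ) - p.ν + Complex.I * p.β / ((n : ℂ) + p.ν + 1) = p.aParam n + 1 := by
    rw [aParam]; ring
  rw [calT, this]

theorem calT_pos (hν : 0 ≤ p.ν) (n : ℕ) : 0 < p.calT n := by
  rw [calT_eq]
  have h1 : 0 < ‖(ascPochhammer ℂ n).eval (p.aParam n + 1)‖ :=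
    norm_pos_iff.2 (ascPochhammer_aParam_ne_zero hν le_rfl)
  have h2 : (0 : ℝ) < n.factorial := by exact_mod_cast n.factorial_pos
  positivity

/-- T(n) is the inverse modulus of the common factor (a_n+1)_n/n!, and (i cot θ - 1)/2 = i e^{iθ}/(2
sin θ) turns the polynomial into powers of a phase over sin θ. -/
theorem calT_sq_mul (hν : 0 ≤ p.ν) (n : ℕ) {θ : ℝ} (hθ : Real.sin θ ≠ 0) :
    (p.calT n : ℂ) ^ 2 * (jacobiP n (p.aParam n) (starRingEnd ℂ (p.aParam n))
        (Complex.I * (Real.cot θ : ℝ))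
      * starRingEnd ℂ (jacobiP n (p.aParam n) (starRingEnd ℂ (p.aParam n))
        (Complex.I * (Real.cot θ : ℝ))))
    = ∑ k ∈ Finset.range (n + 1), ∑ s ∈ Finset.range (n + 1),
        starRingEnd ℂ (p.hyperCoeff n k) * p.hyperCoeff n s
          * ((-Complex.I * Complex.exp (Complex.I * θ) / (2 * (Real.sin θ : ℂ))) ^ s
            * (Complex.I * Complex.exp (-Complex.I * θ) / (2 * (Real.sin θ : ℂ))) ^ k) := by
  set A := (ascPochhammer ℂ n).eval (p.aParam n + 1) with hA
  have hA0 : A ≠ 0 := ascPochhammer_aParam_ne_zero hν le_rfl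
  set F : ℂ := ∑ s ∈ Finset.range (n + 1), p.hyperCoeff n s *
    (-Complex.I * Complex.exp (Complex.I * θ) / (2 * (Real.sin θ : ℂ))) ^ s with hF
  have hP : jacobiP n (p.aParam n) (starRingEnd ℂ (p.aParam n)) (Complex.I * (Real.cot θ : ℝ))
      = A / (n.factorial : ℂ) * F := by
    have hdeg : (jacobiShifted n (p.aParam n) (starRingEnd ℂ (p.aParam n))).natDegree ≤ n := by
      rw [Polynomial.natDegree_le_iff_coeff_eq_zero]
      intro k hk
      rw [jacobiShifted_coeff, if_neg (by omega)]
    rw [← jacobiShifted_eval, I_mul_cot_sub_one hθ,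
      Polynomial.eval_eq_sum_range' (Nat.lt_succ_of_le hdeg), hF, Finset.mul_sum]
    refine Finset.sum_congr rfl fun s hs => ?_
    rw [jacobiShifted_coeff_eq_hyperCoeff hν (Nat.lt_succ_iff.1 (Finset.mem_range.1 hs)), ← hA,
      show -Complex.I * Complex.exp (Complex.I * θ) / (2 * (Real.sin θ : ℂ))
        = -1 * (Complex.I * Complex.exp (Complex.I * θ) / (2 * (Real.sin θ : ℂ))) by ring,
      mul_pow (-1 : ℂ)]
    ring
  have hconjF : starRingEnd ℂ F = ∑ k ∈ Finset.range (n + 1), starRingEnd ℂ (p.hyperCoeff n k) *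
      (Complex.I * Complex.exp (-Complex.I * θ) / (2 * (Real.sin θ : ℂ))) ^ k := by
    rw [hF, map_sum]
    refine Finset.sum_congr rfl fun k _ => ?_
    simp only [map_mul, map_pow, map_div₀, map_neg, Complex.conj_I, Complex.conj_ofReal,
      ← Complex.exp_conj, map_ofNat, neg_neg]
  have hcoef : (p.calT n : ℂ) ^ 2 * (A / (n.factorial : ℂ)
      * starRingEnd ℂ (A / (n.factorial : ℂ))) = 1 := by
    have h7 : (n.factorial : ℝ) ≠ 0 := Nat.cast_ne_zero.2 (Nat.factorial_ne_zero _)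
    rw [Complex.mul_conj, calT_eq, ← hA, Complex.normSq_eq_norm_sq, norm_div, Complex.norm_natCast]
    have hn : ‖A‖ ≠ 0 := norm_ne_zero_iff.2 hA0
    rw [← Complex.ofReal_pow, ← Complex.ofReal_mul, ← Complex.ofReal_one]
    congr 1
    field_simp
  calc _ = (p.calT n : ℂ) ^ 2 * (A / (n.factorial : ℂ) * starRingEnd ℂ (A / (n.factorial : ℂ)))
        * (starRingEnd ℂ F * F) := by rw [hP, map_mul]; ring
    _ = _ := by
      rw [hcoef, one_mul, hconjF, hF, Finset.sum_mul_sum]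
      refine Finset.sum_congr rfl fun k _ => Finset.sum_congr rfl fun s _ => ?_
      ring

theorem calO_eq (n : ℕ) : p.calO n = ∑ k ∈ Finset.range (n + 1), ∑ s ∈ Finset.range (n + 1),
    starRingEnd ℂ (p.hyperCoeff n k) * p.hyperCoeff n s
      * (Complex.Gamma (((2 * p.expo n - s - k : ℝ) : ℂ) + 1)
        / (Complex.Gamma ((p.expo n : ℂ) - k + 1 + Complex.I * (p.β / p.expo n : ℝ))
          * Complex.Gamma ((p.expo n : ℂ) - s + 1 - Complex.I * (p.β / p.expo n : ℝ)))) := by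
  unfold calO
  refine Finset.sum_congr rfl fun k _ => ?_
  rw [Finset.mul_sum]
  refine Finset.sum_congr rfl fun s _ => ?_
  have ha : -(p.ν : ℂ) - n + Complex.I * p.β / ((n : ℂ) + p.ν + 1) = p.aParam n + 1 := by
    rw [aParam]; ring
  have hb : -(p.ν : ℂ) - n - Complex.I * p.β / ((n : ℂ) + p.ν + 1)
      = starRingEnd ℂ (p.aParam n + 1) := by
    simp only [aParam, map_add, map_neg, map_div₀, map_mul, Complex.conj_ofReal,
      Complex.conj_I, map_one, map_natCast]
    ring
  have hc : ∀ z : ℂ, (ascPochhammer ℂ k).eval (starRingEnd ℂ z)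
      = starRingEnd ℂ ((ascPochhammer ℂ k).eval z) := ascPochhammer_eval_conj k
  have hd : Complex.I * p.β / ((n : ℂ) + p.ν + 1) = Complex.I * (p.β / p.expo n : ℝ) := by
    rw [expo]; push_cast; ring
  have e1 : (n : ℂ) + p.ν + 2 - k + Complex.I * p.β / ((n : ℂ) + p.ν + 1)
      = (p.expo n : ℂ) - k + 1 + Complex.I * (p.β / p.expo n : ℝ) := by
    rw [hd, expo]; push_cast; ring
  have e2 : (n : ℂ) + p.ν + 2 - s - Complex.I * p.β / ((n : ℂ) + p.ν + 1)
      = (p.expo n : ℂ) - s + 1 - Complex.I * (p.β / p.expo n : ℝ) := by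
    rw [hd, expo]; push_cast; ring
  have e3 : 2 * (n : ℂ) + 2 * p.ν - s - k + 3 = ((2 * p.expo n - s - k : ℝ) : ℂ) + 1 := by
    rw [expo]; push_cast; ring
  have r1 : starRingEnd ℂ ((ascPochhammer ℂ k).eval (-(n : ℂ)))
      = (ascPochhammer ℂ k).eval (-(n : ℂ)) := by
    rw [← ascPochhammer_eval_conj]; simp
  have r2 : starRingEnd ℂ ((ascPochhammer ℂ k).eval (-2 * (p.ν : ℂ) - n - 1))
      = (ascPochhammer ℂ k).eval (-2 * (p.ν : ℂ) - n - 1) := by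
    rw [← ascPochhammer_eval_conj]
    simp only [map_sub, map_mul, map_neg, map_ofNat, Complex.conj_ofReal, map_natCast, map_one]
  rw [ha, hb, hc, e1, e2, e3, hyperCoeff, hyperCoeff, map_div₀, map_mul, map_mul, r1, r2,
    map_natCast]
  simp only [div_eq_mul_inv, mul_inv]
  ring

/-- Since -i e^{iθ} = e^{i(θ-π/2)}, the powers give the frequency s-k; the weight e^{-2cθ} = e^{-πc}
e^{-2c(θ-π/2)} shifts it by 2ic. The result is an integrand of Cauchy's integral. -/
theorem sin_rpow_mul_eq (n s k : ℕ) (c : ℝ) {θ : ℝ} (hθ : θ ∈ Ioo 0 Real.pi) :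
    ((Real.sin θ ^ p.expo n : ℝ) : ℂ) ^ 2 * ((Real.exp (-(c * θ)) : ℝ) : ℂ) ^ 2
        * ((-Complex.I * Complex.exp (Complex.I * θ) / (2 * (Real.sin θ : ℂ))) ^ s
          * (Complex.I * Complex.exp (-Complex.I * θ) / (2 * (Real.sin θ : ℂ))) ^ k)
      = ((Real.exp (-(Real.pi * c)) * (1 / 2) ^ (s + k) : ℝ) : ℂ)
        * (((Real.sin θ ^ (2 * p.expo n - s - k) : ℝ) : ℂ)
          * Complex.exp (Complex.I * (((s : ℂ) - k) + 2 * Complex.I * c)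
            * ((θ : ℂ) - Real.pi / 2))) := by
  have hsin := Real.sin_pos_of_mem_Ioo hθ
  have hsin' : (Real.sin θ : ℂ) ≠ 0 := by exact_mod_cast hsin.ne'
  have h1 : (Real.sin θ ^ p.expo n) ^ 2
      = Real.sin θ ^ (2 * p.expo n - s - k) * Real.sin θ ^ s * Real.sin θ ^ k := by
    rw [← Real.rpow_natCast, ← Real.rpow_natCast, ← Real.rpow_natCast, ← Real.rpow_add hsin,
      ← Real.rpow_add hsin, ← Real.rpow_mul hsin.le]
    congr 1; push_cast; ring
  have h1' : ((Real.sin θ ^ p.expo n : ℝ) : ℂ) ^ 2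
      = ((Real.sin θ ^ (2 * p.expo n - s - k) : ℝ) : ℂ) * (Real.sin θ : ℂ) ^ s
        * (Real.sin θ : ℂ) ^ k := by exact_mod_cast congrArg Complex.ofReal h1
  have hI1 : -Complex.I = Complex.exp (-(Complex.I * (Real.pi / 2))) := by
    rw [Complex.exp_neg, mul_comm, Complex.exp_pi_div_two_mul_I, Complex.inv_I]
  have hI2 : Complex.exp (Complex.I * (Real.pi / 2)) = Complex.I := by
    rw [mul_comm, Complex.exp_pi_div_two_mul_I]
  have hexp : Complex.exp (Complex.I * (((s : ℂ) - k) + 2 * Complex.I * c)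
      * ((θ : ℂ) - Real.pi / 2))
      = (-Complex.I * Complex.exp (Complex.I * θ)) ^ s
        * (Complex.I * Complex.exp (-Complex.I * θ)) ^ k
        * (((Real.exp (-(c * θ)) : ℝ) : ℂ) ^ 2 * ((Real.exp (Real.pi * c) : ℝ) : ℂ)) := by
    have e1 : -Complex.I * Complex.exp (Complex.I * θ)
        = Complex.exp (Complex.I * ((θ : ℂ) - Real.pi / 2)) := by
      rw [show Complex.I * ((θ : ℂ) - Real.pi / 2)
        = -(Complex.I * (Real.pi / 2)) + Complex.I * θ by ring, Complex.exp_add, ← hI1]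
    have e2 : Complex.I * Complex.exp (-Complex.I * θ)
        = Complex.exp (-(Complex.I * ((θ : ℂ) - Real.pi / 2))) := by
      rw [show -(Complex.I * ((θ : ℂ) - Real.pi / 2))
        = Complex.I * (Real.pi / 2) + -Complex.I * θ by ring, Complex.exp_add, hI2]
    rw [e1, e2, ← Complex.exp_nat_mul, ← Complex.exp_nat_mul, Complex.ofReal_exp,
      Complex.ofReal_exp, ← Complex.exp_nat_mul, ← Complex.exp_add, ← Complex.exp_add,
      ← Complex.exp_add]
    congr 1
    push_cast
    linear_combination (2 * c * ((θ : ℂ) - Real.pi / 2)) * Complex.I_sq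
  have hpc : ((Real.exp (-(Real.pi * c)) : ℝ) : ℂ) * ((Real.exp (Real.pi * c) : ℝ) : ℂ) = 1 := by
    rw [← Complex.ofReal_mul, ← Real.exp_add]; simp
  rw [h1', hexp, div_pow, div_pow, mul_pow 2 _ s, mul_pow 2 _ k, Complex.ofReal_mul,
    Complex.ofReal_pow, pow_add]
  generalize ((Real.exp (-(Real.pi * c)) : ℝ) : ℂ) = E at hpc ⊢
  generalize ((Real.exp (Real.pi * c) : ℝ) : ℂ) = E' at hpc ⊢
  generalize ((Real.exp (-(c * θ)) : ℝ) : ℂ) = G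
  generalize ((Real.sin θ ^ (2 * p.expo n - s - k) : ℝ) : ℂ) = S
  generalize (Real.sin θ : ℂ) = σ at hsin' ⊢
  generalize (-Complex.I * Complex.exp (Complex.I * θ)) ^ s = u
  generalize (Complex.I * Complex.exp (-Complex.I * θ)) ^ k = v
  push_cast
  have h2s : (2 : ℂ) ^ s ≠ 0 := pow_ne_zero _ two_ne_zero
  have h2k : (2 : ℂ) ^ k ≠ 0 := pow_ne_zero _ two_ne_zero
  rw [div_pow, div_pow, one_pow, one_pow]
  field_simp
  linear_combination (- S * G ^ 2 * u * v) * hpc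

theorem integral_norm_sq_polyWave_eigenPoly (hL : 0 < p.L) (hν : 0 ≤ p.ν) (n : ℕ) :
    (p.calT n : ℂ) ^ 2 * ((∫ x in (0 : ℝ)..p.L, ‖p.polyWave n (p.eigenPoly n) x‖ ^ 2 : ℝ) : ℂ)
      = ((p.L * Real.exp (-(Real.pi * (p.β / p.expo n))) * (2 : ℝ) ^ (-(2 * p.expo n)) : ℝ) : ℂ)
        * p.calO n := by
  set c : ℝ := p.β / p.expo n with hc
  have hpi := Real.pi_pos
  set P : ℝ → ℂ := fun θ => jacobiP n (p.aParam n) (starRingEnd ℂ (p.aParam n))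
    (Complex.I * (Real.cot θ : ℝ)) with hP
  set w : ℝ → ℂ := fun θ => ((Real.sin θ ^ p.expo n : ℝ) : ℂ) * ((Real.exp (-(c * θ)) : ℝ) : ℂ)
    * P θ with hw
  have hsub : (∫ x in (0 : ℝ)..p.L, ‖p.polyWave n (p.eigenPoly n) x‖ ^ 2)
      = p.L / Real.pi * ∫ θ in (0 : ℝ)..Real.pi, ‖w θ‖ ^ 2 := by
    have h := intervalIntegral.integral_comp_mul_left (a := 0) (b := p.L)
      (fun θ => ‖w θ‖ ^ 2) (c := Real.pi / p.L) (by positivity)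
    rw [mul_zero, div_mul_cancel₀ _ hL.ne', inv_div, smul_eq_mul] at h
    rw [← h]
    apply intervalIntegral.integral_congr
    intro x _
    simp only [polyWave, hw, hP, eigenPoly_eval, ← hc]
    rw [mul_div_right_comm]
  -- With exponent 2e-s-k, where e = `expo n`, and y = s-k+2ic, Cauchy's Gamma arguments are
  -- e-k+1+ic and e-s+1-ic, as in O(n).
  have hint : ∀ s k : ℕ, s ≤ n → k ≤ n →
      sinExpIntegral (2 * p.expo n - s - k) (((s : ℂ) - k) + 2 * Complex.I * c)
      = Real.pi * ((2 : ℝ) ^ (-(2 * p.expo n - s - k)) : ℝ)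
        * (Complex.Gamma (((2 * p.expo n - s - k : ℝ) : ℂ) + 1)
        / (Complex.Gamma ((p.expo n : ℂ) - k + 1 + Complex.I * c)
          * Complex.Gamma ((p.expo n : ℂ) - s + 1 - Complex.I * c))) := by
    intro s k hs hk
    have hs' : (s : ℝ) ≤ n := by exact_mod_cast hs
    have hk' : (k : ℝ) ≤ n := by exact_mod_cast hk
    have hs0 : (0 : ℝ) ≤ s := Nat.cast_nonneg s
    have hk0 : (0 : ℝ) ≤ k := Nat.cast_nonneg k
    have hre : (((s : ℂ) - k) + 2 * Complex.I * c).re = (s : ℝ) - k := by simp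
    rw [sinExpIntegral_eq]
    · rw [mul_div_assoc]
      congr 4
      · push_cast; ring
      · push_cast; ring
    · unfold expo; linarith
    · rw [hre, abs_lt]
      unfold expo; constructor <;> linarith
  have hcont : ∀ s ∈ Finset.range (n + 1), ∀ k ∈ Finset.range (n + 1),
      IntervalIntegrable (fun θ : ℝ => starRingEnd ℂ (p.hyperCoeff n k) * p.hyperCoeff n s *
        (((Real.exp (-(Real.pi * c)) * (1 / 2) ^ (s + k) : ℝ) : ℂ)
        * (((Real.sin θ ^ (2 * p.expo n - s - k) : ℝ) : ℂ)
          * Complex.exp (Complex.I * (((s : ℂ) - k) + 2 * Complex.I * c)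
            * ((θ : ℂ) - Real.pi / 2))))) volume 0 Real.pi := by
    intro s hs k hk
    have hs' : (s : ℝ) ≤ n := by exact_mod_cast Nat.lt_succ_iff.1 (Finset.mem_range.1 hs)
    have hk' : (k : ℝ) ≤ n := by exact_mod_cast Nat.lt_succ_iff.1 (Finset.mem_range.1 hk)
    exact (((continuous_sinExp (s := 2 * p.expo n - s - k) (by unfold expo; linarith) _).const_mul
      _).const_mul _).intervalIntegrable _ _
  have hmain : (p.calT n : ℂ) ^ 2 * ((∫ θ in (0 : ℝ)..Real.pi, ‖w θ‖ ^ 2 : ℝ) : ℂ)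
      = ((Real.pi * Real.exp (-(Real.pi * c)) * (2 : ℝ) ^ (-(2 * p.expo n)) : ℝ) : ℂ)
        * p.calO n := by
    rw [← intervalIntegral.integral_ofReal, ← intervalIntegral.integral_const_mul]
    have hcongr : ∫ θ in (0 : ℝ)..Real.pi, (p.calT n : ℂ) ^ 2 * ((‖w θ‖ ^ 2 : ℝ) : ℂ)
        = ∫ θ in (0 : ℝ)..Real.pi, ∑ k ∈ Finset.range (n + 1), ∑ s ∈ Finset.range (n + 1),
        starRingEnd ℂ (p.hyperCoeff n k) * p.hyperCoeff n s *
        (((Real.exp (-(Real.pi * c)) * (1 / 2) ^ (s + k) : ℝ) : ℂ)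
        * (((Real.sin θ ^ (2 * p.expo n - s - k) : ℝ) : ℂ)
          * Complex.exp (Complex.I * (((s : ℂ) - k) + 2 * Complex.I * c)
            * ((θ : ℂ) - Real.pi / 2)))) := by
      apply intervalIntegral.integral_congr_Ioo_of_le hpi.le
      intro θ hθ
      have hsin := Real.sin_pos_of_mem_Ioo hθ
      have h1 : ((‖w θ‖ ^ 2 : ℝ) : ℂ) = ((Real.sin θ ^ p.expo n : ℝ) : ℂ) ^ 2
          * ((Real.exp (-(c * θ)) : ℝ) : ℂ) ^ 2 * (P θ * starRingEnd ℂ (P θ)) := by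
        rw [← Complex.normSq_eq_norm_sq, ← Complex.mul_conj]
        simp only [hw, map_mul, Complex.conj_ofReal]
        ring
      simp only
      rw [h1, mul_left_comm, calT_sq_mul hν n hsin.ne', Finset.mul_sum]
      refine Finset.sum_congr rfl fun k _ => ?_
      rw [Finset.mul_sum]
      refine Finset.sum_congr rfl fun s _ => ?_
      rw [mul_left_comm, sin_rpow_mul_eq n s k c hθ]
    rw [hcongr, intervalIntegral.integral_finsetSum, calO_eq, Finset.mul_sum]
    · refine Finset.sum_congr rfl fun k hk => ?_
      rw [intervalIntegral.integral_finsetSum fun s hs => hcont s hs k hk, Finset.mul_sum]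
      refine Finset.sum_congr rfl fun s hs => ?_
      have h := hint s k (Nat.lt_succ_iff.1 (Finset.mem_range.1 hs))
        (Nat.lt_succ_iff.1 (Finset.mem_range.1 hk))
      rw [sinExpIntegral] at h
      rw [intervalIntegral.integral_const_mul, intervalIntegral.integral_const_mul, h]
      have h2 : (2 : ℝ) ^ (-(2 * p.expo n - s - k))
          = (2 : ℝ) ^ (-(2 * p.expo n)) * 2 ^ (s + k) := by
        rw [← Real.rpow_natCast, ← Real.rpow_add two_pos]
        congr 1; push_cast; ring
      have h3 : ((1 / 2 : ℝ) ^ (s + k)) * 2 ^ (s + k) = 1 := by rw [← mul_pow]; norm_num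
      have h3' : (((1 / 2 : ℝ) ^ (s + k) : ℝ) : ℂ) * ((2 ^ (s + k) : ℝ) : ℂ) = 1 := by
        exact_mod_cast congrArg Complex.ofReal h3
      rw [h2]
      simp only [Complex.ofReal_mul]
      linear_combination (Real.pi * ((Real.exp (-(Real.pi * c)) : ℝ) : ℂ)
        * (((2 : ℝ) ^ (-(2 * p.expo n)) : ℝ) : ℂ) * (starRingEnd ℂ (p.hyperCoeff n k)
        * p.hyperCoeff n s * (Complex.Gamma (((2 * p.expo n - s - k : ℝ) : ℂ) + 1)
        / (Complex.Gamma ((p.expo n : ℂ) - k + 1 + Complex.I * c)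
          * Complex.Gamma ((p.expo n : ℂ) - s + 1 - Complex.I * c))))) * h3'
    · intro k hk
      have := IntervalIntegrable.sum (Finset.range (n + 1)) fun s hs => hcont s hs k hk
      refine this.congr fun θ _ => ?_
      simp only [Finset.sum_apply]
  rw [hsub, Complex.ofReal_mul, mul_left_comm, hmain]
  have hpi' : (Real.pi : ℂ) ≠ 0 := by exact_mod_cast hpi.ne'
  push_cast
  field_simp

theorem integral_norm_sq_polyWave_pos (hL : 0 < p.L) (hν : 0 ≤ p.ν) {n : ℕ} {R : Polynomial ℂ}
    (hR : R.natDegree ≤ n) (hR0 : R ≠ 0) :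
    0 < ∫ x in (0 : ℝ)..p.L, ‖p.polyWave n R x‖ ^ 2 := by
  obtain ⟨g, hg, h⟩ := vanishesAtEnds_polyWave hL hν hR
  have hcongr : ∫ x in (0 : ℝ)..p.L, ‖p.polyWave n R x‖ ^ 2
      = ∫ x in (0 : ℝ)..p.L, ‖(Real.sin (Real.pi * x / p.L) : ℂ) * g x‖ ^ 2 :=
    intervalIntegral.integral_congr_Ioo_of_le hL.le fun x hx => by simp only [h x hx]
  rw [hcongr]
  have hcont : Continuous fun x : ℝ => ‖(Real.sin (Real.pi * x / p.L) : ℂ) * g x‖ ^ 2 := by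
    fun_prop
  refine intervalIntegral.integral_pos hL hcont.continuousOn (fun x _ => by positivity) ?_
  by_contra! hcon
  apply hR0
  have hzero : ∀ x ∈ Ioo 0 p.L, R.eval ((Real.cot (Real.pi * x / p.L) : ℝ) : ℂ) = 0 := by
    intro x hx
    have h1 := hcon x (Ioo_subset_Icc_self hx)
    rw [← h x hx] at h1
    have h2 : p.polyWave n R x = 0 := by
      have : ‖p.polyWave n R x‖ ^ 2 = 0 := le_antisymm h1 (by positivity)
      simpa using this
    have hsin := sin_pos_of_mem hL hx
    rw [polyWave] at h2
    have h3 : ((Real.sin (Real.pi * x / p.L) ^ p.expo n : ℝ) : ℂ) ≠ 0 := by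
      exact_mod_cast (Real.rpow_pos_of_pos hsin _).ne'
    have h4 : ((Real.exp (-(p.β / p.expo n * (Real.pi * x / p.L))) : ℝ) : ℂ) ≠ 0 := by
      exact_mod_cast (Real.exp_pos _).ne'
    exact (mul_eq_zero.1 h2).resolve_left (mul_ne_zero h3 h4)
  apply Polynomial.eq_zero_of_infinite_isRoot
  -- The cotangent is injective on (0, π), so a vanishing wave would give R infinitely many roots.
  refine Set.Infinite.mono (s := (fun x : ℝ => ((Real.cot (Real.pi * x / p.L) : ℝ) : ℂ))
    '' Ioo 0 p.L) ?_ ?_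
  · rintro _ ⟨x, hx, rfl⟩
    exact hzero x hx
  · refine (Ioo_infinite hL).image ?_
    intro x hx y hy hxy
    have hcot : Real.cot (Real.pi * x / p.L) = Real.cot (Real.pi * y / p.L) := by
      exact Complex.ofReal_injective hxy
    have hsx := sin_pos_of_mem hL hx
    have hsy := sin_pos_of_mem hL hy
    rw [Real.cot_eq_cos_div_sin, Real.cot_eq_cos_div_sin, div_eq_div_iff hsx.ne' hsy.ne'] at hcot
    have hs : Real.sin (Real.pi * x / p.L - Real.pi * y / p.L) = 0 := by
      rw [Real.sin_sub]; linarith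
    have hpi := Real.pi_pos
    have hlt : ∀ z ∈ Ioo 0 p.L, 0 < Real.pi * z / p.L ∧ Real.pi * z / p.L < Real.pi := by
      intro z hz
      refine ⟨by have := hz.1; positivity, ?_⟩
      rw [div_lt_iff₀ hL]; exact mul_lt_mul_of_pos_left hz.2 hpi
    have h0 := (Real.sin_eq_zero_iff_of_lt_of_lt
      (by linarith [(hlt x hx).1, (hlt y hy).2]) (by linarith [(hlt x hx).2, (hlt y hy).1])).1 hs
    have : Real.pi * x = Real.pi * y := by
      exact (div_left_inj' hL.ne').1 (sub_eq_zero.1 h0)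
    exact mul_left_cancel₀ hpi.ne' this

/-- The double sum is, up to positive constants, the squared norm of a nonzero wave; that is why it
is real and positive. -/
theorem exists_calO_eq_pos (hL : 0 < p.L) (hν : 0 ≤ p.ν) (n : ℕ) :
    ∃ o : ℝ, 0 < o ∧ p.calO n = (o : ℂ) ∧
      p.calT n ^ 2 * (∫ x in (0 : ℝ)..p.L, ‖p.polyWave n (p.eigenPoly n) x‖ ^ 2)
        = p.L * Real.exp (-(Real.pi * (p.β / p.expo n))) * (2 : ℝ) ^ (-(2 * p.expo n)) * o := by
  have h := integral_norm_sq_polyWave_eigenPoly hL hν n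
  have hI := integral_norm_sq_polyWave_pos hL hν (eigenPoly_natDegree_le n)
    (hierPoly_ne_zero hν n 0 (Nat.zero_le n))
  set I := ∫ x in (0 : ℝ)..p.L, ‖p.polyWave n (p.eigenPoly n) x‖ ^ 2
  have hT := calT_pos hν n
  set D : ℝ := p.L * Real.exp (-(Real.pi * (p.β / p.expo n))) * (2 : ℝ) ^ (-(2 * p.expo n))
    with hD
  have hD0 : 0 < D := by positivity
  have hD' : (D : ℂ) ≠ 0 := by exact_mod_cast hD0.ne'
  refine ⟨p.calT n ^ 2 * I / D, by have : 0 < I := hI; positivity, ?_, by field_simp⟩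
  push_cast
  rw [eq_div_iff hD', mul_comm, ← h]

theorem integral_norm_sq_phi (hL : 0 < p.L) (hν : 0 ≤ p.ν) (n : ℕ) :
    ‖p.normK n‖ ^ 2 * (∫ x in (0 : ℝ)..p.L, ‖p.polyWave n (p.eigenPoly n) x‖ ^ 2) = 1 := by
  obtain ⟨o, ho, hO, h⟩ := exists_calO_eq_pos hL hν n
  have hcp : p.calO n ^ (-(1 / 2) : ℂ) = ((o ^ (-(1 / 2) : ℝ) : ℝ) : ℂ) := by
    rw [hO, Complex.ofReal_cpow ho.le]; push_cast; rfl
  have hsq : ∀ y : ℝ, 0 < y → (y ^ (-(1 / 2) : ℝ)) ^ 2 = y⁻¹ := fun y hy => by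
    rw [← Real.rpow_natCast, ← Real.rpow_mul hy.le]
    norm_num
    exact Real.rpow_neg_one y
  have hK : p.normK n = (((2 : ℝ) ^ p.expo n * p.L ^ (-(1 / 2) : ℝ) * p.calT n
      * o ^ (-(1 / 2) : ℝ) * Real.exp (p.β * Real.pi / (2 * p.expo n)) : ℝ) : ℂ) := by
    rw [normK, hcp, expo]; push_cast; rfl
  have h2 : (2 : ℝ) ^ (-(2 * p.expo n)) * ((2 : ℝ) ^ p.expo n) ^ 2 = 1 := by
    rw [← Real.rpow_natCast, ← Real.rpow_mul two_pos.le, ← Real.rpow_add two_pos,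
      show -(2 * p.expo n) + p.expo n * ((2 : ℕ) : ℝ) = 0 by push_cast; ring, Real.rpow_zero]
  have he : Real.exp (-(Real.pi * (p.β / p.expo n)))
      * Real.exp (p.β * Real.pi / (2 * p.expo n)) ^ 2 = 1 := by
    rw [← Real.exp_nat_mul, ← Real.exp_add, Real.exp_eq_one_iff]
    have := (expo_pos hν n).ne'
    push_cast
    field_simp
    ring
  rw [hK, Complex.norm_real, Real.norm_eq_abs, sq_abs]
  set I := ∫ x in (0 : ℝ)..p.L, ‖p.polyWave n (p.eigenPoly n) x‖ ^ 2
  calc _ = ((2 : ℝ) ^ p.expo n) ^ 2 * (p.L ^ (-(1 / 2) : ℝ)) ^ 2 * (o ^ (-(1 / 2) : ℝ)) ^ 2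
        * Real.exp (p.β * Real.pi / (2 * p.expo n)) ^ 2 * (p.calT n ^ 2 * I) := by ring
    _ = (p.L⁻¹ * p.L) * (o⁻¹ * o) * ((2 : ℝ) ^ (-(2 * p.expo n)) * ((2 : ℝ) ^ p.expo n) ^ 2)
        * (Real.exp (-(Real.pi * (p.β / p.expo n)))
        * Real.exp (p.β * Real.pi / (2 * p.expo n)) ^ 2) := by
          rw [h, hsq _ hL, hsq _ ho]; ring
    _ = 1 := by rw [h2, he, inv_mul_cancel₀ hL.ne', inv_mul_cancel₀ ho.ne']; norm_num

/-! ### Scalar multiples of the waves on `(0, L)` -/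

variable (p) in
/-- `f` agrees on `(0, L)` with `c` times the wave of the polynomial `R`. -/
def IsWave (n : ℕ) (R : Polynomial ℂ) (c : ℂ) (f : ℝ → ℂ) : Prop :=
  ∀ x ∈ Ioo 0 p.L, f x = c * p.polyWave n R x

variable (p) in
/-- The superpotential of level `k` is minus the logarithmic derivative of `sin^{k+ν+1}(πx/L)
exp(-βπx/(L(k+ν+1)))`, times `ħ`. -/
def HasExplicitSuperpot (k : ℕ) : Prop :=
  ∀ x ∈ Ioo 0 p.L, p.superpot k x = ((-(p.ħ * Real.pi / p.L) *
    (p.expo k * Real.cot (Real.pi * x / p.L) - p.β / p.expo k) : ℝ) : ℂ)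

theorem isWave_polyWave (n : ℕ) (R : Polynomial ℂ) : p.IsWave n R 1 (p.polyWave n R) :=
  fun _ _ => (one_mul _).symm

theorem IsWave.hasDerivAt {n : ℕ} {R : Polynomial ℂ} {c : ℂ} {f : ℝ → ℂ} (hL : 0 < p.L)
    (hf : p.IsWave n R c f) {x : ℝ} (hx : x ∈ Ioo 0 p.L) :
    HasDerivAt f (c * ((Real.pi / p.L : ℝ) * p.polyWave n (p.derivPoly n R) x)) x :=
  ((hasDerivAt_polyWave hL n R hx).const_mul c).congr_of_eventuallyEq
    (eventually_of_mem (isOpen_Ioo.mem_nhds hx) hf)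

theorem IsWave.deriv {n : ℕ} {R : Polynomial ℂ} {c : ℂ} {f : ℝ → ℂ} (hL : 0 < p.L)
    (hf : p.IsWave n R c f) :
    p.IsWave n (p.derivPoly n R) (c * (Real.pi / p.L : ℝ)) (deriv f) := fun x hx => by
  rw [(hf.hasDerivAt hL hx).deriv]; ring

theorem IsWave.contDiffOn {n : ℕ} {R : Polynomial ℂ} {c : ℂ} {f : ℝ → ℂ} (hL : 0 < p.L)
    (hf : p.IsWave n R c f) : ContDiffOn ℝ ∞ f (Ioo 0 p.L) :=
  (contDiffOn_const.mul (contDiffOn_polyWave hL n R)).congr hf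

theorem IsWave.locAC {n : ℕ} {R : Polynomial ℂ} {c : ℂ} {f : ℝ → ℂ} (hL : 0 < p.L)
    (hf : p.IsWave n R c f) : p.LocAC f :=
  locAC_of_contDiffOn ((hf.contDiffOn hL).of_le (by norm_cast))

theorem IsWave.vanishesAtEnds {n : ℕ} {R : Polynomial ℂ} {c : ℂ} {f : ℝ → ℂ} (hL : 0 < p.L)
    (hν : 0 ≤ p.ν) (hR : R.natDegree ≤ n) (hf : p.IsWave n R c f) : p.VanishesAtEnds f :=
  ((vanishesAtEnds_polyWave hL hν hR).const_mul c).congr hf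

theorem IsWave.of_C_mul {n : ℕ} {R : Polynomial ℂ} {c d : ℂ} {f : ℝ → ℂ}
    (hf : p.IsWave n (Polynomial.C d * R) c f) : p.IsWave n R (c * d) f := fun x hx => by
  rw [hf x hx, polyWave_C_mul]; ring

theorem polyWave_add (n : ℕ) (R S : Polynomial ℂ) (x : ℝ) :
    p.polyWave n (R + S) x = p.polyWave n R x + p.polyWave n S x := by
  simp only [polyWave, Polynomial.eval_add]; ring

theorem polyWave_mul (n : ℕ) (R S : Polynomial ℂ) (x : ℝ) : p.polyWave n (R * S) x
    = R.eval ((Real.cot (Real.pi * x / p.L) : ℝ) : ℂ) * p.polyWave n S x := by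
  simp only [polyWave, Polynomial.eval_mul]; ring

theorem groundPoly_eval_cot (k : ℕ) (t : ℝ) : (p.groundPoly k).eval (t : ℂ)
    = ((p.expo k * t - p.β / p.expo k : ℝ) : ℂ) := by
  simp [groundPoly]

theorem IsWave.opA {n k : ℕ} {R : Polynomial ℂ} {c : ℂ} {f : ℝ → ℂ} (hL : 0 < p.L)
    (hW : p.HasExplicitSuperpot k) (hf : p.IsWave n R c f) :
    p.IsWave n (p.raisePoly n k R) (c * (p.ħ * Real.pi / p.L : ℝ)) (p.opA k f) := by
  intro x hx
  have e : p.polyWave n (p.raisePoly n k R) x = p.polyWave n (p.derivPoly n R) x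
      - (p.groundPoly k).eval ((Real.cot (Real.pi * x / p.L) : ℝ) : ℂ) * p.polyWave n R x := by
    rw [← polyWave_mul, eq_sub_iff_add_eq, ← polyWave_add, raisePoly, sub_add_cancel]
  rw [PoschlTeller.opA, (hf.hasDerivAt hL hx).deriv, hW x hx, hf x hx, e, groundPoly_eval_cot]
  push_cast
  ring

theorem IsWave.opAdag {n k : ℕ} {R : Polynomial ℂ} {c : ℂ} {f : ℝ → ℂ} (hL : 0 < p.L)
    (hW : p.HasExplicitSuperpot k) (hf : p.IsWave n R c f) :
    p.IsWave n (p.lowerPoly n k R) (c * (p.ħ * Real.pi / p.L : ℝ)) (p.opAdag k f) := by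
  intro x hx
  have e : p.polyWave n (p.lowerPoly n k R) x = -p.polyWave n (p.derivPoly n R) x
      - (p.groundPoly k).eval ((Real.cot (Real.pi * x / p.L) : ℝ) : ℂ) * p.polyWave n R x := by
    have h : p.polyWave n (p.derivPoly n R) x + p.polyWave n (p.lowerPoly n k R) x
        + p.polyWave n (p.groundPoly k * R) x = 0 := by
      rw [← polyWave_add, ← polyWave_add, lowerPoly]
      ring_nf
      simp [polyWave]
    rw [polyWave_mul] at h
    linear_combination h
  rw [PoschlTeller.opAdag, (hf.hasDerivAt hL hx).deriv, hW x hx, hf x hx, e, groundPoly_eval_cot]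
  push_cast
  ring

/-! ### The normalization constants -/

theorem normK_ne_zero (hL : 0 < p.L) (hν : 0 ≤ p.ν) (n : ℕ) : p.normK n ≠ 0 := by
  intro h
  have := integral_norm_sq_phi hL hν n
  rw [h] at this
  simp at this

theorem two_mul_M_mul_eps0 (hM : 0 < p.M) (hL : 0 < p.L) :
    2 * p.M * p.eps0 = (p.ħ * Real.pi / p.L) ^ 2 := by
  unfold eps0; field_simp

theorem energy_eq (n : ℕ) : p.energy n = p.eps0 * p.redEnergy n := by
  rw [energy, redEnergy, expo, div_pow]

theorem energyHier_eq (m n : ℕ) : p.energyHier m n = p.energy (n + m) := by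
  induction m generalizing n with
  | zero => rfl
  | succ m ih => rw [energyHier, ih]; congr 1; omega

variable (p) in
/-- The product of the first `k` energy differences of `φ_n`, in units of `ε₀`. -/
def gapProd (n k : ℕ) : ℝ := ∏ j ∈ Finset.range k, (p.redEnergy n - p.redEnergy j)

theorem gapProd_pos (hν : 0 ≤ p.ν) {n k : ℕ} (hk : k ≤ n) : 0 < p.gapProd n k :=
  Finset.prod_pos fun _ hj =>
    redEnergy_sub_pos hν ((Finset.mem_range.1 hj).trans_le hk)

theorem normHier_eq (hħ : 0 < p.ħ) (hM : 0 < p.M) (hL : 0 < p.L) (k n : ℕ) :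
    p.normHier k n = (p.ħ * Real.pi / p.L) ^ k * Real.sqrt (p.gapProd (n + k) k) := by
  have hκ : 0 ≤ (p.ħ * Real.pi / p.L) ^ k := by have := Real.pi_pos; positivity
  have : (2 * p.M) ^ k * ∏ j ∈ Finset.range k, (p.energy (n + k) - p.energy j)
      = ((p.ħ * Real.pi / p.L) ^ k) ^ 2 * p.gapProd (n + k) k := by
    have h : ∀ j ∈ Finset.range k, p.energy (n + k) - p.energy j
        = p.eps0 * (p.redEnergy (n + k) - p.redEnergy j) := fun _ _ => by
      rw [energy_eq, energy_eq]; ring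
    rw [Finset.prod_congr rfl h, Finset.prod_mul_distrib, Finset.prod_const, Finset.card_range,
      ← mul_assoc, ← mul_pow, two_mul_M_mul_eps0 hM hL, gapProd, ← pow_mul, ← pow_mul,
      mul_comm 2 k]
  rw [normHier, this, Real.sqrt_mul (sq_nonneg _), Real.sqrt_sq hκ]

/-- The factors of M² are the gaps in factored form, the difference and the sum of the exponents
being n+m+1-k and n+m+2ν+k+3. -/
theorem calM_eq (hν : 0 ≤ p.ν) (n m : ℕ) :
    p.calM n m = Real.sqrt (p.gapProd (n + (m + 1)) (m + 1)) := by
  rw [calM, gapProd]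
  congr 1
  refine Finset.prod_congr rfl fun k _ => ?_
  rw [redEnergy_sub hν]
  unfold expo
  push_cast
  ring

theorem normHier_pos (hħ : 0 < p.ħ) (hM : 0 < p.M) (hL : 0 < p.L) (hν : 0 ≤ p.ν) (k n : ℕ) :
    0 < p.normHier k n := by
  rw [normHier_eq hħ hM hL]
  have := Real.pi_pos
  have := Real.sqrt_pos.2 (gapProd_pos hν (Nat.le_add_left k n))
  positivity

/-! ### The hierarchy -/

theorem isWave_phi (n : ℕ) : p.IsWave n (p.eigenPoly n) (p.normK n) (p.phi n) := by
  intro x _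
  rw [phi, polyWave, eigenPoly_eval, show p.ν + n + 1 = p.expo n by rw [expo]; ring,
    show p.β * Real.pi * x / (p.L * p.expo n) = p.β / p.expo n * (Real.pi * x / p.L) by
      simp only [div_eq_mul_inv, mul_inv]; ring]
  ring

theorem isWave_ladder (hL : 0 < p.L) {k : ℕ} (hW : ∀ j < k, p.HasExplicitSuperpot j) (n : ℕ) :
    p.IsWave n (p.hierPoly n k) (p.normK n * ((p.ħ * Real.pi / p.L : ℝ) : ℂ) ^ k)
      (p.ladder k (p.phi n)) := by
  induction k with
  | zero => simpa [hierPoly, ladder] using isWave_phi n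
  | succ k ih =>
    have h := (ih fun j hj => hW j (hj.trans (Nat.lt_succ_self k))).opA hL
      (hW k (Nat.lt_succ_self k))
    rw [pow_succ, ← mul_assoc]
    exact h

theorem polyWave_C_ne_zero (hL : 0 < p.L) (n : ℕ) {c : ℂ} (hc : c ≠ 0) {x : ℝ}
    (hx : x ∈ Ioo 0 p.L) : p.polyWave n (Polynomial.C c) x ≠ 0 := by
  have h3 : ((Real.sin (Real.pi * x / p.L) ^ p.expo n : ℝ) : ℂ) ≠ 0 := by
    exact_mod_cast (Real.rpow_pos_of_pos (sin_pos_of_mem hL hx) _).ne'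
  have h4 : ((Real.exp (-(p.β / p.expo n * (Real.pi * x / p.L))) : ℝ) : ℂ) ≠ 0 := by
    exact_mod_cast (Real.exp_pos _).ne'
  rw [polyWave, Polynomial.eval_C]
  exact mul_ne_zero (mul_ne_zero h3 h4) hc

/-- The ladder producing the ground state of level k uses only W_j with j < k, so strong induction
makes that state a wave. Its polynomial is a nonzero constant, hence its logarithmic derivative is
that of the prefactor. -/
theorem hasExplicitSuperpot (hħ : 0 < p.ħ) (hM : 0 < p.M) (hL : 0 < p.L) (hν : 0 ≤ p.ν)
    (k : ℕ) : p.HasExplicitSuperpot k := by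
  induction k using Nat.strong_induction_on with
  | _ k ih =>
    intro x hx
    obtain ⟨c, hc, hcp⟩ := hierPoly_self hν k
    have hlad := isWave_ladder hL ih k
    have hN : (p.normHier k 0 : ℂ) ≠ 0 := by
      exact_mod_cast (normHier_pos hħ hM hL hν k 0).ne'
    have hκ : ((p.ħ * Real.pi / p.L : ℝ) : ℂ) ≠ 0 := by
      have := Real.pi_pos
      exact_mod_cast (by positivity : p.ħ * Real.pi / p.L ≠ 0)
    have hw : p.IsWave k (Polynomial.C c)
        (p.normK k * ((p.ħ * Real.pi / p.L : ℝ) : ℂ) ^ k / (p.normHier k 0 : ℂ))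
        (p.phiHier k 0) := fun y hy => by
      rw [phiHier, Nat.zero_add, hlad y hy, hcp]; ring
    have hd : p.normK k * ((p.ħ * Real.pi / p.L : ℝ) : ℂ) ^ k / (p.normHier k 0 : ℂ) ≠ 0 :=
      div_ne_zero (mul_ne_zero (normK_ne_zero hL hν k) (pow_ne_zero _ hκ)) hN
    generalize p.normK k * ((p.ħ * Real.pi / p.L : ℝ) : ℂ) ^ k / (p.normHier k 0 : ℂ) = d at hw hd
    have hderiv : p.derivPoly k (Polynomial.C c) = p.groundPoly k * Polynomial.C c := by
      simp [derivPoly]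
    have hne := polyWave_C_ne_zero hL k hc hx
    rw [superpot, superpotOf, (hw.hasDerivAt hL hx).deriv, hw x hx, hderiv, polyWave_mul,
      groundPoly_eval_cot]
    push_cast
    field_simp

/-- The k ladder steps give (ħπ/L)^k, which the normalization cancels because 2Mε₀ = (ħπ/L)². -/
theorem isWave_phiHier (hħ : 0 < p.ħ) (hM : 0 < p.M) (hL : 0 < p.L) (hν : 0 ≤ p.ν) (k n : ℕ) :
    p.IsWave (n + k) (p.hierPoly (n + k) k)
      (p.normK (n + k) / (Real.sqrt (p.gapProd (n + k) k) : ℝ)) (p.phiHier k n) := by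
  intro x hx
  rw [phiHier, isWave_ladder hL (fun j _ => hasExplicitSuperpot hħ hM hL hν j) (n + k) x hx,
    normHier_eq hħ hM hL]
  have hκ : ((p.ħ * Real.pi / p.L : ℝ) : ℂ) ^ k ≠ 0 := by
    have := Real.pi_pos
    exact pow_ne_zero _ (by exact_mod_cast (by positivity : p.ħ * Real.pi / p.L ≠ 0))
  have hs : ((Real.sqrt (p.gapProd (n + k) k) : ℝ) : ℂ) ≠ 0 := by
    exact_mod_cast (Real.sqrt_pos.2 (gapProd_pos hν (Nat.le_add_left k n))).ne'
  rw [Complex.ofReal_mul, Complex.ofReal_pow]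
  generalize ((p.ħ * Real.pi / p.L : ℝ) : ℂ) ^ k = κ at hκ ⊢
  field_simp

theorem phiHier_zero_ne_zero (hħ : 0 < p.ħ) (hM : 0 < p.M) (hL : 0 < p.L) (hν : 0 ≤ p.ν) (k : ℕ)
    {x : ℝ} (hx : x ∈ Ioo 0 p.L) : p.phiHier k 0 x ≠ 0 := by
  obtain ⟨c, hc, hcp⟩ := hierPoly_self hν k
  have h := isWave_phiHier hħ hM hL hν k 0 x hx
  rw [Nat.zero_add, hcp] at h
  rw [h]
  refine mul_ne_zero (div_ne_zero (normK_ne_zero hL hν k) ?_) (polyWave_C_ne_zero hL k hc hx)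
  exact_mod_cast (Real.sqrt_pos.2 (gapProd_pos hν le_rfl)).ne'

/-! ### Domains and norms along the hierarchy -/

theorem IsWave.lower_hierPoly {n k : ℕ} {c : ℂ} {f : ℝ → ℂ} (hħ : 0 < p.ħ) (hM : 0 < p.M)
    (hL : 0 < p.L) (hν : 0 ≤ p.ν) (hf : p.IsWave n (p.hierPoly n (k + 1)) c f) :
    p.IsWave n (p.hierPoly n k) (c * (p.ħ * Real.pi / p.L : ℝ)
      * ((p.redEnergy n - p.redEnergy k : ℝ) : ℂ)) (p.opAdag k f) := by
  have h := hf.opAdag hL (hasExplicitSuperpot hħ hM hL hν k)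
  rw [lowerPoly_hierPoly_succ hν] at h
  exact h.of_C_mul

theorem memDomA_of_isWave {n k : ℕ} {c : ℂ} {f : ℝ → ℂ} (hħ : 0 < p.ħ) (hM : 0 < p.M)
    (hL : 0 < p.L) (hν : 0 ≤ p.ν) (hk : k ≤ n) (hf : p.IsWave n (p.hierPoly n k) c f) :
    p.MemDomA k f := by
  refine ⟨(hf.vanishesAtEnds hL hν (hierPoly_natDegree_le hν n k (by omega))).memL2,
    hf.locAC hL, ?_⟩
  have h : p.IsWave n (p.hierPoly n (k + 1)) _ _ := hf.opA hL (hasExplicitSuperpot hħ hM hL hν k)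
  exact (h.vanishesAtEnds hL hν (hierPoly_natDegree_le hν n (k + 1) (by omega))).memL2

theorem memDomAdag_of_isWave {n k : ℕ} {c : ℂ} {f : ℝ → ℂ} (hħ : 0 < p.ħ) (hM : 0 < p.M)
    (hL : 0 < p.L) (hν : 0 ≤ p.ν) (hk : k ≤ n) (hf : p.IsWave n (p.hierPoly n (k + 1)) c f) :
    p.MemDomAdag k f := by
  refine memDomAdag_of_vanishesAtEnds hL (fun x hx => ?_)
    ((hf.contDiffOn hL).of_le (by norm_cast))
    (hf.vanishesAtEnds hL hν (hierPoly_natDegree_le hν n (k + 1) (by omega)))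
    ((hf.lower_hierPoly hħ hM hL hν).vanishesAtEnds hL hν
      (hierPoly_natDegree_le hν n k (by omega))).memL2
  rw [hasExplicitSuperpot hħ hM hL hν k x hx, Complex.conj_ofReal]

theorem innerL2_congr {u u' v v' : ℝ → ℂ} (hu : EqOn u u' (Ioo 0 p.L))
    (hv : EqOn v v' (Ioo 0 p.L)) : p.innerL2 u v = p.innerL2 u' v' :=
  setIntegral_congr_fun measurableSet_Ioo fun x hx => by simp only [hu hx, hv hx]

theorem innerL2_const_mul (c d : ℂ) (u v : ℝ → ℂ) :
    p.innerL2 (fun x => c * u x) (fun x => d * v x) = starRingEnd ℂ c * d * p.innerL2 u v := by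
  rw [innerL2, innerL2, ← integral_const_mul]
  congr 1
  ext x
  rw [map_mul]; ring

/-- Adjointness with ψ the wave of level k and f that of level k+1: A_k ψ is a multiple of f, and
A_k† f is the same multiple of the gap times ψ. -/
theorem innerL2_polyWave_succ (hħ : 0 < p.ħ) (hM : 0 < p.M) (hL : 0 < p.L) (hν : 0 ≤ p.ν)
    {n k : ℕ} (hk : k ≤ n) :
    p.innerL2 (p.polyWave n (p.hierPoly n (k + 1))) (p.polyWave n (p.hierPoly n (k + 1)))
      = ((p.redEnergy n - p.redEnergy k : ℝ) : ℂ)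
        * p.innerL2 (p.polyWave n (p.hierPoly n k)) (p.polyWave n (p.hierPoly n k)) := by
  have hψ := isWave_polyWave (p := p) n (p.hierPoly n k)
  have hf := isWave_polyWave (p := p) n (p.hierPoly n (k + 1))
  have h := ((memDomAdag_of_isWave hħ hM hL hν hk hf).2.2.2 _
    (memDomA_of_isWave hħ hM hL hν hk hψ)).2
  have h1 : p.IsWave n (p.hierPoly n (k + 1)) _ _ := hψ.opA hL (hasExplicitSuperpot hħ hM hL hν k)
  have h2 := hf.lower_hierPoly hħ hM hL hν
  rw [innerL2_congr (fun x hx => h1 x hx) (fun x hx => hf x hx),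
    innerL2_congr (fun x hx => hψ x hx) (fun x hx => h2 x hx), innerL2_const_mul,
    innerL2_const_mul] at h
  have hκ : ((p.ħ * Real.pi / p.L : ℝ) : ℂ) ≠ 0 := by
    have := Real.pi_pos
    exact_mod_cast (by positivity : p.ħ * Real.pi / p.L ≠ 0)
  rw [map_mul, map_one, Complex.conj_ofReal] at h
  apply mul_left_cancel₀ hκ
  linear_combination h

theorem innerL2_polyWave_hierPoly (hħ : 0 < p.ħ) (hM : 0 < p.M) (hL : 0 < p.L) (hν : 0 ≤ p.ν)
    {n k : ℕ} (hk : k ≤ n + 1) :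
    p.innerL2 (p.polyWave n (p.hierPoly n k)) (p.polyWave n (p.hierPoly n k))
      = (p.gapProd n k : ℂ)
        * p.innerL2 (p.polyWave n (p.eigenPoly n)) (p.polyWave n (p.eigenPoly n)) := by
  induction k with
  | zero => simp [gapProd, hierPoly]
  | succ k ih =>
    rw [innerL2_polyWave_succ hħ hM hL hν (by omega), ih (by omega), gapProd, gapProd,
      Finset.prod_range_succ]
    push_cast
    ring

theorem innerL2_polyWave_eigenPoly (hL : 0 < p.L) (hν : 0 ≤ p.ν) (n : ℕ) :
    starRingEnd ℂ (p.normK n) * p.normK n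
      * p.innerL2 (p.polyWave n (p.eigenPoly n)) (p.polyWave n (p.eigenPoly n)) = 1 := by
  have h1 : p.innerL2 (p.polyWave n (p.eigenPoly n)) (p.polyWave n (p.eigenPoly n))
      = ((∫ x in (0 : ℝ)..p.L, ‖p.polyWave n (p.eigenPoly n) x‖ ^ 2 : ℝ) : ℂ) := by
    rw [innerL2, intervalIntegral.integral_of_le hL.le, integral_Ioc_eq_integral_Ioo,
      ← integral_complex_ofReal]
    congr 1
    ext x
    rw [← Complex.normSq_eq_norm_sq, ← Complex.mul_conj, mul_comm]
  rw [h1, mul_comm (starRingEnd ℂ _), Complex.mul_conj, Complex.normSq_eq_norm_sq,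
    ← Complex.ofReal_mul, integral_norm_sq_phi hL hν, Complex.ofReal_one]

theorem isUnitVector_phiHier (hħ : 0 < p.ħ) (hM : 0 < p.M) (hL : 0 < p.L) (hν : 0 ≤ p.ν)
    (k n : ℕ) : p.IsUnitVector (p.phiHier k n) := by
  have hw := isWave_phiHier hħ hM hL hν k n
  refine ⟨(hw.vanishesAtEnds hL hν (hierPoly_natDegree_le hν _ k (by omega))).memL2, ?_⟩
  have hg := gapProd_pos hν (Nat.le_add_left k n)
  have hs : ((Real.sqrt (p.gapProd (n + k) k) : ℝ) : ℂ) ≠ 0 := by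
    exact_mod_cast (Real.sqrt_pos.2 hg).ne'
  have hss : ((Real.sqrt (p.gapProd (n + k) k) : ℝ) : ℂ) ^ 2 = (p.gapProd (n + k) k : ℂ) := by
    exact_mod_cast congrArg Complex.ofReal (Real.sq_sqrt hg.le)
  rw [innerL2_congr (fun x hx => hw x hx) (fun x hx => hw x hx), innerL2_const_mul,
    innerL2_polyWave_hierPoly hħ hM hL hν (by omega), ← hss, map_div₀, Complex.conj_ofReal]
  have h := innerL2_polyWave_eigenPoly hL hν (n + k)
  field_simp
  linear_combination h

/-! ### Eigenvalue equations and the action of the operator products -/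

theorem phiHier_zero (n : ℕ) : p.phiHier 0 n = p.phi n := by
  ext x
  simp [phiHier, ladder, normHier]

theorem eigenvalue_equation (hM : 0 < p.M) (hL : 0 < p.L) (hν : 0 ≤ p.ν) (n : ℕ) {x : ℝ}
    (hx : x ∈ Ioo 0 p.L) : p.hamiltonian (p.phi n) x = (p.energy n : ℂ) * p.phi n x := by
  have hw := isWave_phi (p := p) n
  have hpoly := lowerPoly_raisePoly hν n 0 (p.eigenPoly n)
  rw [lowerPoly_raisePoly_eigenPoly hν] at hpoly
  -- Arranged as D²R + gap·R = potential·R, free of negation, so additivity of the wave in R yields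
  -- the pointwise equation.
  have h := congrArg (fun q => p.polyWave n q x) (eq_neg_add_iff_add_eq.1 hpoly)
  simp only [polyWave_add, polyWave_mul, Polynomial.eval_sub, Polynomial.eval_mul,
    Polynomial.eval_add, Polynomial.eval_C, Polynomial.eval_X, Polynomial.eval_one,
    Polynomial.eval_pow] at h
  have hsin := sin_pos_of_mem hL hx
  have hsc : 1 / Real.sin (Real.pi * x / p.L) ^ 2 = 1 + Real.cot (Real.pi * x / p.L) ^ 2 := by
    rw [Real.cot_eq_cos_div_sin]
    have := Real.sin_sq_add_cos_sq (Real.pi * x / p.L)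
    field_simp
    linarith
  have hV : p.potential x = p.eps0 * (p.ν * (p.ν + 1)
      * (1 + Real.cot (Real.pi * x / p.L) ^ 2) - 2 * p.β * Real.cot (Real.pi * x / p.L)) := by
    rw [potential, ← hsc]; ring
  have hE : p.ħ ^ 2 / (2 * p.M) * (Real.pi / p.L) ^ 2 = p.eps0 := by
    unfold eps0; field_simp
  have hE' : ((p.ħ ^ 2 / (2 * p.M) : ℝ) : ℂ) * ((Real.pi / p.L : ℝ) : ℂ) ^ 2 = (p.eps0 : ℂ) := by
    exact_mod_cast congrArg Complex.ofReal hE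
  have he : (p.expo 0 : ℂ) = p.ν + 1 := by simp [expo]
  rw [he] at h
  rw [hamiltonian, ((hw.deriv hL).deriv hL) x hx, hw x hx, hV, energy_eq]
  generalize p.polyWave n (p.derivPoly n (p.derivPoly n (p.eigenPoly n))) x = U at h ⊢
  generalize p.polyWave n (p.eigenPoly n) x = Y at h ⊢
  push_cast at h hE' ⊢
  linear_combination -p.normK n * U * hE' - p.normK n * p.eps0 * h

theorem isNormalizedEigenfunction_phi (hħ : 0 < p.ħ) (hM : 0 < p.M) (hL : 0 < p.L)
    (hν : 0 ≤ p.ν) (n : ℕ) : p.IsNormalizedEigenfunction (p.energy n) (p.phi n) := by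
  have hw := isWave_phi (p := p) n
  have hv := hw.vanishesAtEnds hL hν (eigenPoly_natDegree_le n)
  have heq := fun x hx => eigenvalue_equation (p := p) hM hL hν n (x := x) hx
  refine ⟨⟨hv.memL2, hw.locAC hL, (hw.deriv hL).locAC hL, hv.tendsto_left hL,
    hv.tendsto_right hL, ((hv.const_mul (p.energy n)).congr heq).memL2⟩, ?_, heq⟩
  rw [← phiHier_zero]
  exact isUnitVector_phiHier hħ hM hL hν 0 n

theorem isNormalizedEigenfunctionHier_phiHier (hħ : 0 < p.ħ) (hM : 0 < p.M) (hL : 0 < p.L)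
    (hν : 0 ≤ p.ν) (m n : ℕ) :
    p.IsNormalizedEigenfunctionHier m (p.energyHier (m + 1) n) (p.phiHier (m + 1) n) := by
  have hw := isWave_phiHier hħ hM hL hν (m + 1) n
  have hl := hw.lower_hierPoly hħ hM hL hν
  have hu : p.IsWave (n + (m + 1)) (p.hierPoly (n + (m + 1)) (m + 1)) _ _ :=
    hl.opA hL (hasExplicitSuperpot hħ hM hL hν m)
  refine ⟨⟨memDomAdag_of_isWave hħ hM hL hν (by omega) hw,
    memDomA_of_isWave hħ hM hL hν (by omega) hl⟩, isUnitVector_phiHier hħ hM hL hν (m + 1) n,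
    fun x hx => ?_⟩
  have h2 : 1 / (2 * p.M) * (p.ħ * Real.pi / p.L) ^ 2 = p.eps0 := by
    rw [← two_mul_M_mul_eps0 hM hL]; field_simp
  have h2' : ((1 / (2 * p.M) : ℝ) : ℂ) * ((p.ħ * Real.pi / p.L : ℝ) : ℂ) ^ 2 = (p.eps0 : ℂ) := by
    exact_mod_cast congrArg Complex.ofReal h2
  rw [hamiltonianHier, hu x hx, hw x hx, energyHier_eq, energyHier_eq, Nat.zero_add, energy_eq,
    energy_eq]
  generalize p.polyWave (n + (m + 1)) (p.hierPoly (n + (m + 1)) (m + 1)) x = Y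
  generalize p.normK (n + (m + 1)) / _ = c
  rw [Complex.ofReal_mul, Complex.ofReal_mul, Complex.ofReal_sub]
  linear_combination c * ((p.redEnergy (n + (m + 1)) : ℂ) - p.redEnergy m) * Y * h2'

/-- The rightmost factor of the product lowers first, so the induction runs over arbitrary waves;
each factor contributes ħπ/L and one gap. -/
theorem isWave_ladderDag (hħ : 0 < p.ħ) (hM : 0 < p.M) (hL : 0 < p.L) (hν : 0 ≤ p.ν) {n k : ℕ}
    {c : ℂ} {f : ℝ → ℂ} (hf : p.IsWave n (p.hierPoly n k) c f) :
    p.IsWave n (p.eigenPoly n) (c * ((p.ħ * Real.pi / p.L : ℝ) : ℂ) ^ k * (p.gapProd n k : ℂ))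
      (p.ladderDag k f) := by
  induction k generalizing c f with
  | zero => simpa [gapProd, ladderDag, hierPoly] using hf
  | succ k ih =>
    have h := ih (hf.lower_hierPoly hħ hM hL hν)
    intro x hx
    rw [ladderDag, h x hx, gapProd, gapProd, Finset.prod_range_succ, Complex.ofReal_mul]
    ring

theorem memDomLadderDag_of_isWave (hħ : 0 < p.ħ) (hM : 0 < p.M) (hL : 0 < p.L) (hν : 0 ≤ p.ν)
    {n k : ℕ} (hk : k ≤ n + 1) {c : ℂ} {f : ℝ → ℂ} (hf : p.IsWave n (p.hierPoly n k) c f) :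
    p.MemDomLadderDag k f := by
  induction k generalizing c f with
  | zero => exact (hf.vanishesAtEnds hL hν (hierPoly_natDegree_le hν n 0 (by omega))).memL2
  | succ k ih =>
    exact ⟨memDomAdag_of_isWave hħ hM hL hν (by omega) hf,
      ih (by omega) (hf.lower_hierPoly hħ hM hL hν)⟩

theorem memDomLadder_phi (hħ : 0 < p.ħ) (hM : 0 < p.M) (hL : 0 < p.L) (hν : 0 ≤ p.ν)
    {n k : ℕ} (hk : k ≤ n + 1) : p.MemDomLadder k (p.phi n) := by
  induction k with
  | zero =>
    exact ((isWave_phi n).vanishesAtEnds hL hν (eigenPoly_natDegree_le n)).memL2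
  | succ k ih =>
    exact ⟨ih (by omega), memDomA_of_isWave hħ hM hL hν (by omega)
      (isWave_ladder hL (fun j _ => hasExplicitSuperpot hħ hM hL hν j) n)⟩

theorem opB_phi (hħ : 0 < p.ħ) (hM : 0 < p.M) (hL : 0 < p.L) (hν : 0 ≤ p.ν) (n m : ℕ) (x : ℝ) :
    p.opB m (p.phi (n + m + 1)) x
      = ((Real.pi * p.ħ / p.L : ℝ) : ℂ) ^ (m + 1) * p.calM n m * p.phiHier (m + 1) n x := by
  have hN : (p.normHier (m + 1) n : ℂ) ≠ 0 := by
    exact_mod_cast (normHier_pos hħ hM hL hν (m + 1) n).ne'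
  have h : ((Real.pi * p.ħ / p.L : ℝ) : ℂ) ^ (m + 1) * p.calM n m = p.normHier (m + 1) n := by
    rw [normHier_eq hħ hM hL, calM_eq hν, mul_comm Real.pi]
    push_cast
    rfl
  rw [h, phiHier, mul_div_cancel₀ _ hN]
  rfl

theorem opBdag_phiHier (hħ : 0 < p.ħ) (hM : 0 < p.M) (hL : 0 < p.L) (hν : 0 ≤ p.ν) (n m : ℕ)
    {x : ℝ} (hx : x ∈ Ioo 0 p.L) :
    p.opBdag m (p.phiHier (m + 1) n) x
      = ((p.ħ * Real.pi / p.L : ℝ) : ℂ) ^ (m + 1) * p.calM n m * p.phi (n + m + 1) x := by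
  have h := isWave_ladderDag hħ hM hL hν (isWave_phiHier hħ hM hL hν (m + 1) n) x hx
  have hg := gapProd_pos hν (Nat.le_add_left (m + 1) n)
  have hs : ((Real.sqrt (p.gapProd (n + (m + 1)) (m + 1)) : ℝ) : ℂ) ≠ 0 := by
    exact_mod_cast (Real.sqrt_pos.2 hg).ne'
  have hss : ((Real.sqrt (p.gapProd (n + (m + 1)) (m + 1)) : ℝ) : ℂ) ^ 2
      = (p.gapProd (n + (m + 1)) (m + 1) : ℂ) := by
    exact_mod_cast congrArg Complex.ofReal (Real.sq_sqrt hg.le)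
  have hφ : p.phi (n + m + 1) x = p.normK (n + (m + 1))
      * p.polyWave (n + (m + 1)) (p.eigenPoly (n + (m + 1))) x := isWave_phi (n + m + 1) x hx
  -- The full product of gaps over its square root from the normalization leaves one factor M(n,m).
  rw [opBdag, h, hφ, calM_eq hν, ← hss]
  field_simp

end PoschlTeller

end

/-! ### The theorem -/

theorem proposition4 (p : PoschlTeller) (hħ : 0 < p.ħ) (hM : 0 < p.M) (hL : 0 < p.L)
    (hν : 0 ≤ p.ν) (hβ : 0 ≤ p.β) (n m : ℕ) :
    -- the ground states have no zeros and all functions involved are smooth on `(0, L)`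
    (∀ k ≤ m, ∀ x ∈ Ioo 0 p.L, p.phiHier k 0 x ≠ 0) ∧
    (∀ k ≤ m + 1, ∀ j : ℕ, ContDiffOn ℝ ∞ (p.phiHier k j) (Ioo 0 p.L)) ∧
    -- the functions acted upon are normalized eigenfunctions
    p.IsNormalizedEigenfunction (p.energy n) (p.phi n) ∧
    p.IsNormalizedEigenfunctionHier m (p.energyHier (m + 1) n) (p.phiHier (m + 1) n) ∧
    -- the action of `B_m†`
    p.MemDomBdag m (p.phiHier (m + 1) n) ∧
    (∀ x ∈ Ioo 0 p.L,
      p.opBdag m (p.phiHier (m + 1) n) x =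
        ((2 : ℝ) ^ ((n : ℝ) + m + p.ν + 2) : ℝ) * ((p.ħ * Real.pi / p.L : ℝ) : ℂ) ^ (m + 1)
          * p.calT (n + m + 1) * ((p.L : ℂ) * p.calO (n + m + 1)) ^ (-(1 / 2) : ℂ)
          * (Real.exp (p.β * Real.pi / ((n : ℝ) + m + p.ν + 2) * (1 / 2 - x / p.L)) : ℝ)
          * p.calM n m
          * ((Real.sin (Real.pi * x / p.L) ^ ((n : ℝ) + m + p.ν + 2) : ℝ) : ℂ)
          * jacobiP (n + m + 1) (p.aParam (n + m + 1)) (starRingEnd ℂ (p.aParam (n + m + 1)))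
              (Complex.I * (Real.cot (Real.pi * x / p.L) : ℝ))) ∧
    -- the action of `B_m`
    p.MemDomB m (p.phi (n + m + 1)) ∧
    (∀ x ∈ Ioo 0 p.L,
      p.opB m (p.phi (n + m + 1)) x =
        ((Real.pi * p.ħ / p.L : ℝ) : ℂ) ^ (m + 1) * p.calM n m * p.phiHier (m + 1) n x) := by
  refine ⟨fun k _ x hx => PoschlTeller.phiHier_zero_ne_zero hħ hM hL hν k hx,
    fun k _ j => (PoschlTeller.isWave_phiHier hħ hM hL hν k j).contDiffOn hL,
    PoschlTeller.isNormalizedEigenfunction_phi hħ hM hL hν n,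
    PoschlTeller.isNormalizedEigenfunctionHier_phiHier hħ hM hL hν m n,
    PoschlTeller.memDomLadderDag_of_isWave hħ hM hL hν (by omega)
      (PoschlTeller.isWave_phiHier hħ hM hL hν (m + 1) n), fun x hx => ?_,
    PoschlTeller.memDomLadder_phi hħ hM hL hν (by omega),
    fun x _ => PoschlTeller.opB_phi hħ hM hL hν n m x⟩
  obtain ⟨o, ho, hO, -⟩ := PoschlTeller.exists_calO_eq_pos hL hν (n + m + 1)
  have e1 : ((n + m + 1 : ℕ) : ℝ) + p.ν + 1 = (n : ℝ) + m + p.ν + 2 := by push_cast; ring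
  have hne : (n : ℝ) + m + p.ν + 2 ≠ 0 := by positivity
  -- A complex power need not split over products; it does here because O(n+m+1) is a positive real.
  have hLO : ((p.L : ℂ) * p.calO (n + m + 1)) ^ (-(1 / 2) : ℂ)
      = ((p.L ^ (-(1 / 2) : ℝ) : ℝ) : ℂ) * p.calO (n + m + 1) ^ (-(1 / 2) : ℂ) := by
    rw [hO, Complex.mul_cpow_ofReal_nonneg hL.le ho.le, Complex.ofReal_cpow hL.le]
    push_cast; rfl
  have hexp : Real.exp (p.β * Real.pi / ((n : ℝ) + m + p.ν + 2) * (1 / 2 - x / p.L))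
      = Real.exp (p.β * Real.pi / (2 * ((n : ℝ) + m + p.ν + 2)))
        * Real.exp (-(p.β * Real.pi * x / (p.L * ((n : ℝ) + m + p.ν + 2)))) := by
    rw [← Real.exp_add]
    congr 1
    field_simp
    ring
  rw [PoschlTeller.opBdag_phiHier hħ hM hL hν n m hx, PoschlTeller.phi, PoschlTeller.normK, hLO,
    hexp, e1, show p.ν + ((n + m + 1 : ℕ) : ℝ) + 1 = (n : ℝ) + m + p.ν + 2 by push_cast; ring,
    Complex.ofReal_mul]
  ring
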